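/- A \emph{monoidal monad} in a monoidal category $\langle\mathcal A,\otimes,I,a,l,r\rangle$, with $a_{A,B,C}:(A\otimes B)\otimes C\to A\otimes(B\otimes C)$, $l_A:I\otimes A\to A$ and $r_A:A\otimes I\to A$, is a monad $\langle T,\eta,\mu\rangle$ in $\mathcal A$ with two natural transformations $\psi^L_{A,B}:TA\otimes B\to T(A\otimes B)$ and $\psi^R_{A,B}:A\otimes TB\to T(A\otimes B)$ such that \begin{align*} Ta_{A,B,C}\circ\psi^L_{A\otimes B,C}\circ(\psi^L_{A,B}\otimes 1_C)&=\psi^L_{A,B\otimes C}\circ a_{TA,B,C}, & Tr_A\circ\psi^L_{A,I}&=r_{TA},\\ Ta_{A,B,C}\circ\psi^R_{A\otimes B,C}&=\psi^R_{A,B\otimes C}\circ(1_A\otimes\psi^R_{B,C})\circ a_{A,B,TC}, & Tl_A\circ\psi^R_{I,A}&=l_{TA},\\ \psi^L_{A,B}\circ(\eta_A\otimes 1_B)&=\eta_{A\otimes B}, & \psi^R_{A,B}\circ(1_A\otimes\eta_B)&=\eta_{A\otimes B},\\ \psi^L_{A,B}\circ(\mu_A\otimes 1_B)&=\mu_{A\otimes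 B}\circ T\psi^L_{A,B}\circ\psi^L_{TA,B}, & \psi^R_{A,B}\circ(1_A\otimes\mu_B)&=\mu_{A\otimes B}\circ T\psi^R_{A,B}\circ\psi^R_{A,TB}, \end{align*} \[ Ta_{A,B,C}\circ\psi^L_{A\otimes B,C}\circ(\psi^R_{A,B}\otimes 1_C)=\psi^R_{A,B\otimes C}\circ(1_A\otimes\psi^L_{B,C})\circ a_{A,TB,C}, \] \[ \mu_{A\otimes B}\circ T\psi^L_{A,B}\circ\psi^R_{TA,B}=\mu_{A\otimes B}\circ T\psi^R_{A,B}\circ\psi^L_{A,TB}. \] Let $\mathcal{LS}$ be the category of the monoidal monad freely generated by an arbitrary set $S$ of objects. Its objects are the formal expressions built from letters in $S$ with $I$, $\otimes$, $T$. Its arrows are the arrow terms (built from $1$, $a^{\pm1}$, $l^{\pm1}$, $r^{\pm1}$, $\eta$, $\mu$, $\psi^L$, $\psi^R$ by composition, $\otimes$ and $T$) modulo the congruence generated by the equations of monoidal categories, of monads and the equations above, including functoriality and naturality. Let $\mathit{Fun}$ be the category whose objects are the finite ordinals and whose arrows are all functions between them. The functor $G:\mathcal{LS}\to\mathit{Fun}$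 sends an object $A$ to the number $GA$ of occurrences of $T$ in $A$, these occurrences being numbered $0,1,2,\dots$ from right to left. It sends an arrow term $f:A\to B$ to its graph, a function from the occurrences of $T$ in $A$ to the occurrences of $T$ in $B$, defined as follows. For $1,a^{\pm1},l^{\pm1},r^{\pm1},\psi^L_{A,B}$ and $\psi^R_{A,B}$ it is the evident bijection (for $\psi^L_{A,B}$ and $\psi^R_{A,B}$ the displayed $T$ of the source goes to the outermost $T$ of the target, and occurrences in $A$ and in $B$ go to the same occurrences in $A$ and $B$). For $\eta_A:A\to TA$ it is the inclusion of the occurrences in $A$, which misses the outermost $T$ of $TA$. For $\mu_A:TTA\to TA$ it sends the two outermost occurrences of $T$ to the outermost one and is the identity on the occurrences in $A$. The graph of $f\otimes g$ is the disjoint union of those of $f$ and $g$; the graph of $Tf$ is that of $f$ extended by sending the outermost $T$ to the outermost $T$; the graph of $g\circ f$ is the composite. Then $G$ is faithful. Moreover, two arrow terms $f,g:A\to B$ denote the same arrow of $\mathcal{LS}$ if and only if they have the same graph. -/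

import Mathlib

open CategoryTheory MonoidalCategory

universe v u w

/-- A monoidal monad in a monoidal category, with the left and right strengths as primitives:
a monad with natural transformations `ψL : TA ⊗ B ⟶ T(A ⊗ B)` and `ψR : A ⊗ TB ⟶ T(A ⊗ B)`
making `T` a left strong and a right strong monad and a locally monoidal endofunctor, such that
the two composites `TA ⊗ TB ⟶ T(A ⊗ B)` coincide. -/
structure MonoidalMonad (C : Type u) [Category.{v} C] [MonoidalCategory C] where
  T : Monad C
  ψL : ∀ A B : C, T.obj A ⊗ B ⟶ T.obj (A ⊗ B)
  ψR : ∀ A B : C, A ⊗ T.obj B ⟶ T.obj (A ⊗ B)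
  ψL_nat : ∀ {A A' B B' : C} (f : A ⟶ A') (g : B ⟶ B'),
    (T.map f ⊗ₘ g) ≫ ψL A' B' = ψL A B ≫ T.map (f ⊗ₘ g)
  ψR_nat : ∀ {A A' B B' : C} (f : A ⟶ A') (g : B ⟶ B'),
    (f ⊗ₘ T.map g) ≫ ψR A' B' = ψR A B ≫ T.map (f ⊗ₘ g)
  ψL_a : ∀ A B D : C, (ψL A B ⊗ₘ 𝟙 D) ≫ ψL (A ⊗ B) D ≫ T.map (α_ A B D).hom =
    (α_ (T.obj A) B D).hom ≫ ψL A (B ⊗ D)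
  ψL_r : ∀ A : C, ψL A (𝟙_ C) ≫ T.map (ρ_ A).hom = (ρ_ (T.obj A)).hom
  ψR_a : ∀ A B D : C, ψR (A ⊗ B) D ≫ T.map (α_ A B D).hom =
    (α_ A B (T.obj D)).hom ≫ (𝟙 A ⊗ₘ ψR B D) ≫ ψR A (B ⊗ D)
  ψR_l : ∀ A : C, ψR (𝟙_ C) A ≫ T.map (λ_ A).hom = (λ_ (T.obj A)).hom
  ψL_η : ∀ A B : C, (T.η.app A ⊗ₘ 𝟙 B) ≫ ψL A B = T.η.app (A ⊗ B)
  ψL_μ : ∀ A B : C, (T.μ.app A ⊗ₘ 𝟙 B) ≫ ψL A B =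
    ψL (T.obj A) B ≫ T.map (ψL A B) ≫ T.μ.app (A ⊗ B)
  ψR_η : ∀ A B : C, (𝟙 A ⊗ₘ T.η.app B) ≫ ψR A B = T.η.app (A ⊗ B)
  ψR_μ : ∀ A B : C, (𝟙 A ⊗ₘ T.μ.app B) ≫ ψR A B =
    ψR A (T.obj B) ≫ T.map (ψR A B) ≫ T.μ.app (A ⊗ B)
  ψLψR_a : ∀ A B D : C, (ψR A B ⊗ₘ 𝟙 D) ≫ ψL (A ⊗ B) D ≫ T.map (α_ A B D).hom =
    (α_ A (T.obj B) D).hom ≫ (𝟙 A ⊗ₘ ψL B D) ≫ ψR A (B ⊗ D)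
  ψLψR_μ : ∀ A B : C, ψR (T.obj A) B ≫ T.map (ψL A B) ≫ T.μ.app (A ⊗ B) =
    ψL A (T.obj B) ≫ T.map (ψR A B) ≫ T.μ.app (A ⊗ B)

/-- The objects of the monoidal monad freely generated by the set of objects `S`: formal
expressions built from letters in `S` with `I`, `⊗` and `T`. -/
inductive LS (S : Type u) : Type u
  | letter : S → LS S
  | unit : LS S
  | tensor : LS S → LS S → LS S
  | T : LS S → LS S

namespace LS

variable {S : Type u}

/-- Arrow terms. Composition is written in diagrammatic order: `comp f g` is "`g` after `f`". -/
inductive Term : LS S → LS S → Type u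
  | one (A : LS S) : Term A A
  | comp {A B C : LS S} (f : Term A B) (g : Term B C) : Term A C
  | tensor {A A' B B' : LS S} (f : Term A A') (g : Term B B') :
      Term (A.tensor B) (A'.tensor B')
  | map {A B : LS S} (f : Term A B) : Term A.T B.T
  | a (A B C : LS S) : Term ((A.tensor B).tensor C) (A.tensor (B.tensor C))
  | aInv (A B C : LS S) : Term (A.tensor (B.tensor C)) ((A.tensor B).tensor C)
  | l (A : LS S) : Term (unit.tensor A) A
  | lInv (A : LS S) : Term A (unit.tensor A)
  | r (A : LS S) : Term (A.tensor unit) A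
  | rInv (A : LS S) : Term A (A.tensor unit)
  | η (A : LS S) : Term A A.T
  | μ (A : LS S) : Term A.T.T A.T
  | ψL (A B : LS S) : Term (A.T.tensor B) (A.tensor B).T
  | ψR (A B : LS S) : Term (A.tensor B.T) (A.tensor B).T

open Term in
/-- Equality of arrow terms: the congruence generated by the equations of monoidal monads. -/
inductive Eqv : ∀ {A B : LS S}, Term A B → Term A B → Prop
  -- equivalence relation and congruence
  | refl {A B : LS S} (f : Term A B) : Eqv f f
  | symm {A B : LS S} {f g : Term A B} : Eqv f g → Eqv g f
  | trans {A B : LS S} {f g h : Term A B} : Eqv f g → Eqv g h → Eqv f h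
  | comp {A B C : LS S} {f f' : Term A B} {g g' : Term B C} :
      Eqv f f' → Eqv g g' → Eqv (f.comp g) (f'.comp g')
  | tensor {A A' B B' : LS S} {f f' : Term A A'} {g g' : Term B B'} :
      Eqv f f' → Eqv g g' → Eqv (f.tensor g) (f'.tensor g')
  | map {A B : LS S} {f f' : Term A B} : Eqv f f' → Eqv f.map f'.map
  -- category
  | id_comp {A B : LS S} (f : Term A B) : Eqv ((one A).comp f) f
  | comp_id {A B : LS S} (f : Term A B) : Eqv (f.comp (one B)) f
  | assoc {A B C D : LS S} (f : Term A B) (g : Term B C) (h : Term C D) :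
      Eqv ((f.comp g).comp h) (f.comp (g.comp h))
  -- monoidal category
  | tensor_id (A B : LS S) : Eqv ((one A).tensor (one B)) (one (A.tensor B))
  | tensor_comp {A₁ B₁ C₁ A₂ B₂ C₂ : LS S} (f₁ : Term A₁ B₁) (f₂ : Term A₂ B₂)
      (g₁ : Term B₁ C₁) (g₂ : Term B₂ C₂) :
      Eqv ((f₁.tensor f₂).comp (g₁.tensor g₂)) ((f₁.comp g₁).tensor (f₂.comp g₂))
  | a_nat {A A' B B' C C' : LS S} (f : Term A A') (g : Term B B') (h : Term C C') :
      Eqv (((f.tensor g).tensor h).comp (a A' B' C')) ((a A B C).comp (f.tensor (g.tensor h)))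
  | l_nat {A B : LS S} (f : Term A B) : Eqv (((one unit).tensor f).comp (l B)) ((l A).comp f)
  | r_nat {A B : LS S} (f : Term A B) : Eqv ((f.tensor (one unit)).comp (r B)) ((r A).comp f)
  | a_aInv (A B C : LS S) : Eqv ((a A B C).comp (aInv A B C)) (one _)
  | aInv_a (A B C : LS S) : Eqv ((aInv A B C).comp (a A B C)) (one _)
  | l_lInv (A : LS S) : Eqv ((l A).comp (lInv A)) (one _)
  | lInv_l (A : LS S) : Eqv ((lInv A).comp (l A)) (one _)
  | r_rInv (A : LS S) : Eqv ((r A).comp (rInv A)) (one _)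
  | rInv_r (A : LS S) : Eqv ((rInv A).comp (r A)) (one _)
  | pentagon (A B C D : LS S) :
      Eqv (((a A B C).tensor (one D)).comp ((a A (B.tensor C) D).comp ((one A).tensor (a B C D))))
        ((a (A.tensor B) C D).comp (a A B (C.tensor D)))
  | triangle (A B : LS S) :
      Eqv ((a A unit B).comp ((one A).tensor (l B))) ((r A).tensor (one B))
  -- monad
  | map_id (A : LS S) : Eqv (one A).map (one A.T)
  | map_comp {A B C : LS S} (f : Term A B) (g : Term B C) :
      Eqv (f.comp g).map (f.map.comp g.map)
  | η_nat {A B : LS S} (f : Term A B) : Eqv (f.comp (η B)) ((η A).comp f.map)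
  | μ_nat {A B : LS S} (f : Term A B) : Eqv (f.map.map.comp (μ B)) ((μ A).comp f.map)
  | μ_assoc (A : LS S) : Eqv ((μ A).map.comp (μ A)) ((μ A.T).comp (μ A))
  | η_μ (A : LS S) : Eqv ((η A.T).comp (μ A)) (one A.T)
  | map_η_μ (A : LS S) : Eqv ((η A).map.comp (μ A)) (one A.T)
  -- left strength
  | ψL_nat {A A' B B' : LS S} (f : Term A A') (g : Term B B') :
      Eqv ((f.map.tensor g).comp (ψL A' B')) ((ψL A B).comp (f.tensor g).map)
  | ψL_a (A B C : LS S) :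
      Eqv (((ψL A B).tensor (one C)).comp ((ψL (A.tensor B) C).comp (a A B C).map))
        ((a A.T B C).comp (ψL A (B.tensor C)))
  | ψL_r (A : LS S) : Eqv ((ψL A unit).comp (r A).map) (r A.T)
  | ψL_η (A B : LS S) : Eqv (((η A).tensor (one B)).comp (ψL A B)) (η (A.tensor B))
  | ψL_μ (A B : LS S) : Eqv (((μ A).tensor (one B)).comp (ψL A B))
      ((ψL A.T B).comp ((ψL A B).map.comp (μ (A.tensor B))))
  -- right strength
  | ψR_nat {A A' B B' : LS S} (f : Term A A') (g : Term B B') :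
      Eqv ((f.tensor g.map).comp (ψR A' B')) ((ψR A B).comp (f.tensor g).map)
  | ψR_a (A B C : LS S) : Eqv ((ψR (A.tensor B) C).comp (a A B C).map)
      ((a A B C.T).comp (((one A).tensor (ψR B C)).comp (ψR A (B.tensor C))))
  | ψR_l (A : LS S) : Eqv ((ψR unit A).comp (l A).map) (l A.T)
  | ψR_η (A B : LS S) : Eqv (((one A).tensor (η B)).comp (ψR A B)) (η (A.tensor B))
  | ψR_μ (A B : LS S) : Eqv (((one A).tensor (μ B)).comp (ψR A B))
      ((ψR A B.T).comp ((ψR A B).map.comp (μ (A.tensor B))))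
  -- interaction of the strengths
  | ψLψR_a (A B C : LS S) :
      Eqv (((ψR A B).tensor (one C)).comp ((ψL (A.tensor B) C).comp (a A B C).map))
        ((a A B.T C).comp (((one A).tensor (ψL B C)).comp (ψR A (B.tensor C))))
  | ψLψR_μ (A B : LS S) : Eqv ((ψR A.T B).comp ((ψL A B).map.comp (μ (A.tensor B))))
      ((ψL A B.T).comp ((ψR A B).map.comp (μ (A.tensor B))))

instance termSetoid (A B : LS S) : Setoid (Term A B) :=
  ⟨Eqv, Eqv.refl, Eqv.symm, Eqv.trans⟩

/-- The category of the freely generated monoidal monad: arrows are arrow terms modulo the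
equations. -/
instance category : Category.{u} (LS S) where
  Hom A B := Quotient (termSetoid A B)
  id A := ⟦Term.one A⟧
  comp := Quotient.map₂ Term.comp (fun _ _ hf _ _ hg => Eqv.comp hf hg)
  id_comp := by rintro _ _ ⟨f⟩; exact Quotient.sound (Eqv.id_comp f)
  comp_id := by rintro _ _ ⟨f⟩; exact Quotient.sound (Eqv.comp_id f)
  assoc := by rintro _ _ _ _ ⟨f⟩ ⟨g⟩ ⟨h⟩; exact Quotient.sound (Eqv.assoc f g h)

/-- The arrow of `LS S` denoted by an arrow term. -/
def Term.arrow {A B : LS S} (f : Term A B) : A ⟶ B :=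
  Quotient.mk (termSetoid A B) f

instance monoidalStruct : MonoidalCategoryStruct (LS S) where
  tensorObj := tensor
  tensorUnit := unit
  tensorHom := Quotient.map₂ Term.tensor (fun _ _ hf _ _ hg => Eqv.tensor hf hg)
  whiskerLeft A _ _ := Quotient.map (Term.tensor (Term.one A)) (fun _ _ h => Eqv.tensor (.refl _) h)
  whiskerRight f B :=
    Quotient.map (fun f => Term.tensor f (Term.one B)) (fun _ _ h => Eqv.tensor h (.refl _)) f
  associator A B C := ⟨(Term.a A B C).arrow, (Term.aInv A B C).arrow,
    Quotient.sound (.a_aInv A B C), Quotient.sound (.aInv_a A B C)⟩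
  leftUnitor A := ⟨(Term.l A).arrow, (Term.lInv A).arrow,
    Quotient.sound (.l_lInv A), Quotient.sound (.lInv_l A)⟩
  rightUnitor A := ⟨(Term.r A).arrow, (Term.rInv A).arrow,
    Quotient.sound (.r_rInv A), Quotient.sound (.rInv_r A)⟩

instance monoidal : MonoidalCategory (LS S) :=
  MonoidalCategory.ofTensorHom
    (id_tensorHom_id := fun A B => Quotient.sound (.tensor_id A B))
    (id_tensorHom := by rintro _ _ _ ⟨f⟩; rfl)
    (tensorHom_id := by rintro _ _ ⟨f⟩ _; rfl)
    (tensorHom_comp_tensorHom := by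
      rintro _ _ _ _ _ _ ⟨f₁⟩ ⟨f₂⟩ ⟨g₁⟩ ⟨g₂⟩; exact Quotient.sound (.tensor_comp f₁ f₂ g₁ g₂))
    (associator_naturality := by
      rintro _ _ _ _ _ _ ⟨f⟩ ⟨g⟩ ⟨h⟩; exact Quotient.sound (.a_nat f g h))
    (leftUnitor_naturality := by rintro _ _ ⟨f⟩; exact Quotient.sound (.l_nat f))
    (rightUnitor_naturality := by rintro _ _ ⟨f⟩; exact Quotient.sound (.r_nat f))
    (pentagon := fun A B C D => Quotient.sound (.pentagon A B C D))
    (triangle := fun A B => Quotient.sound (.triangle A B))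

/-- The monad of the freely generated monoidal monad. -/
def monad (S : Type u) : Monad (LS S) where
  obj := T
  map := Quotient.map Term.map (fun _ _ h => Eqv.map h)
  map_id A := Quotient.sound (.map_id A)
  map_comp := by rintro _ _ _ ⟨f⟩ ⟨g⟩; exact Quotient.sound (.map_comp f g)
  η := { app := fun A => (Term.η A).arrow
         naturality := by rintro _ _ ⟨f⟩; exact Quotient.sound (.η_nat f) }
  μ := { app := fun A => (Term.μ A).arrow
         naturality := by rintro _ _ ⟨f⟩; exact Quotient.sound (.μ_nat f) }
  assoc A := Quotient.sound (.μ_assoc A)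
  left_unit A := Quotient.sound (.η_μ A)
  right_unit A := Quotient.sound (.map_η_μ A)

/-- `LS S` carries a monoidal monad. -/
def monoidalMonad (S : Type u) : MonoidalMonad (LS S) where
  T := monad S
  ψL A B := (Term.ψL A B).arrow
  ψR A B := (Term.ψR A B).arrow
  ψL_nat := by rintro _ _ _ _ ⟨f⟩ ⟨g⟩; exact Quotient.sound (.ψL_nat f g)
  ψR_nat := by rintro _ _ _ _ ⟨f⟩ ⟨g⟩; exact Quotient.sound (.ψR_nat f g)
  ψL_a A B C := Quotient.sound (.ψL_a A B C)
  ψL_r A := Quotient.sound (.ψL_r A)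
  ψR_a A B C := Quotient.sound (.ψR_a A B C)
  ψR_l A := Quotient.sound (.ψR_l A)
  ψL_η A B := Quotient.sound (.ψL_η A B)
  ψL_μ A B := Quotient.sound (.ψL_μ A B)
  ψR_η A B := Quotient.sound (.ψR_η A B)
  ψR_μ A B := Quotient.sound (.ψR_μ A B)
  ψLψR_a A B C := Quotient.sound (.ψLψR_a A B C)
  ψLψR_μ A B := Quotient.sound (.ψLψR_μ A B)

section Interpretation

variable {C : Type w} [Category.{v} C] [MonoidalCategory C] (M : MonoidalMonad C) (val : S → C)

/-- The value of an object in a monoidal monad, for given values of the letters. -/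
def valueObj : LS S → C
  | letter p => val p
  | unit => 𝟙_ C
  | tensor A B => valueObj A ⊗ valueObj B
  | T A => M.T.obj (valueObj A)

/-- The value of an arrow term in a monoidal monad, for given values of the letters. -/
def valueArrow : ∀ {A B : LS S}, Term A B → (valueObj M val A ⟶ valueObj M val B)
  | _, _, .one _ => 𝟙 _
  | _, _, .comp f g => valueArrow f ≫ valueArrow g
  | _, _, .tensor f g => valueArrow f ⊗ₘ valueArrow g
  | _, _, .map f => M.T.map (valueArrow f)
  | _, _, .a _ _ _ => (α_ _ _ _).hom
  | _, _, .aInv _ _ _ => (α_ _ _ _).inv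
  | _, _, .l _ => (λ_ _).hom
  | _, _, .lInv _ => (λ_ _).inv
  | _, _, .r _ => (ρ_ _).hom
  | _, _, .rInv _ => (ρ_ _).inv
  | _, _, .η _ => M.T.η.app _
  | _, _, .μ _ => M.T.μ.app _
  | _, _, .ψL _ _ => M.ψL _ _
  | _, _, .ψR _ _ => M.ψR _ _

/-- The equations between arrow terms hold in every monoidal monad. -/
theorem valueArrow_eq {A B : LS S} {f g : Term A B} (h : Eqv f g) :
    valueArrow M val f = valueArrow M val g := by
  induction h with
  | refl => rfl
  | symm _ ih => exact ih.symm
  | trans _ _ ih₁ ih₂ => exact ih₁.trans ih₂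
  | comp _ _ ih₁ ih₂ => simp only [valueArrow, ih₁, ih₂]
  | tensor _ _ ih₁ ih₂ => exact congrArg₂ _ ih₁ ih₂
  | map _ ih => exact congrArg M.T.map ih
  | id_comp => exact Category.id_comp _
  | comp_id => exact Category.comp_id _
  | assoc => exact Category.assoc _ _ _
  | tensor_id => exact id_tensorHom_id _ _
  | tensor_comp => exact tensorHom_comp_tensorHom _ _ _ _
  | a_nat => exact associator_naturality _ _ _
  | l_nat => simp [valueArrow, valueObj]
  | r_nat => simp [valueArrow, valueObj]
  | a_aInv => exact Iso.hom_inv_id _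
  | aInv_a => exact Iso.inv_hom_id _
  | l_lInv => exact Iso.hom_inv_id _
  | lInv_l => exact Iso.inv_hom_id _
  | r_rInv => exact Iso.hom_inv_id _
  | rInv_r => exact Iso.inv_hom_id _
  | pentagon => simp [valueArrow, valueObj]
  | triangle => simp [valueArrow, valueObj]
  | map_id => exact M.T.map_id _
  | map_comp => exact M.T.map_comp _ _
  | η_nat => exact M.T.η.naturality _
  | μ_nat => exact M.T.μ.naturality _
  | μ_assoc => exact M.T.assoc _
  | η_μ => exact M.T.left_unit _
  | map_η_μ => exact M.T.right_unit _
  | ψL_nat => exact M.ψL_nat _ _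
  | ψL_a => exact M.ψL_a _ _ _
  | ψL_r => exact M.ψL_r _
  | ψL_η => exact M.ψL_η _ _
  | ψL_μ => exact M.ψL_μ _ _
  | ψR_nat => exact M.ψR_nat _ _
  | ψR_a => exact M.ψR_a _ _ _
  | ψR_l => exact M.ψR_l _
  | ψR_η => exact M.ψR_η _ _
  | ψR_μ => exact M.ψR_μ _ _
  | ψLψR_a => exact M.ψLψR_a _ _ _
  | ψLψR_μ => exact M.ψLψR_μ _ _

/-- Freeness of `LS S`: values of the letters in a category with a monoidal monad extend to a
functor that strictly preserves the whole structure. -/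
def valueFunctor : LS S ⥤ C where
  obj := valueObj M val
  map := Quotient.lift (valueArrow M val) (fun _ _ h => valueArrow_eq M val h)
  map_id _ := rfl
  map_comp := by rintro _ _ _ ⟨f⟩ ⟨g⟩; rfl

end Interpretation

/-- The occurrences of `T` in an object: `none : Occ (T A)` is the outermost occurrence. -/
def Occ : LS S → Type
  | letter _ => Empty
  | unit => Empty
  | tensor A B => Occ A ⊕ Occ B
  | T A => Option (Occ A)

/-- The number of occurrences of `T` in an object. -/
def count : LS S → ℕ
  | letter _ => 0
  | unit => 0
  | tensor A B => count B + count A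
  | T A => count A + 1

/-- The occurrences of `T`, numbered `0, 1, 2, …` from right to left. -/
def number : ∀ A : LS S, Occ A ≃ Fin (count A)
  | letter _ => Equiv.equivOfIsEmpty Empty (Fin 0)
  | unit => Equiv.equivOfIsEmpty Empty (Fin 0)
  | tensor A B => ((Equiv.sumComm (Occ A) (Occ B)).trans
      (Equiv.sumCongr (number B) (number A))).trans finSumFinEquiv
  | T A => (Equiv.optionCongr (number A)).trans finSuccEquivLast.symm

/-- The graph of an arrow term, as a function on occurrences of `T`. -/
def graph : ∀ {A B : LS S}, Term A B → Occ A → Occ B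
  | _, _, .one _ => fun x => x
  | _, _, .comp f g => fun x => graph g (graph f x)
  | _, _, .tensor f g => Sum.map (graph f) (graph g)
  | _, _, .map f => Option.map (graph f)
  | _, _, .a A B C => Equiv.sumAssoc (Occ A) (Occ B) (Occ C)
  | _, _, .aInv A B C => (Equiv.sumAssoc (Occ A) (Occ B) (Occ C)).symm
  | _, _, .l _ => Sum.elim Empty.elim (fun x => x)
  | _, _, .lInv _ => Sum.inr
  | _, _, .r _ => Sum.elim (fun x => x) Empty.elim
  | _, _, .rInv _ => Sum.inl
  | _, _, .η _ => some
  | _, _, .μ _ => fun x => Option.elim x none (fun y => y)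
  | _, _, .ψL _ _ => Sum.elim (Option.map Sum.inl) (fun y => some (Sum.inr y))
  | _, _, .ψR _ _ => Sum.elim (fun x => some (Sum.inl x)) (Option.map Sum.inr)

/-- Equal arrow terms have the same graph. -/
theorem graph_eq {A B : LS S} {f g : Term A B} (h : Eqv f g) : graph f = graph g := by
  induction h with
  | refl => rfl
  | symm _ ih => exact ih.symm
  | trans _ _ ih₁ ih₂ => exact ih₁.trans ih₂
  | comp _ _ ih₁ ih₂ => simp only [graph, ih₁, ih₂]
  | tensor _ _ ih₁ ih₂ => exact congrArg₂ Sum.map ih₁ ih₂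
  | map _ ih => exact congrArg Option.map ih
  | id_comp | comp_id | assoc => rfl
  | a_aInv => funext x; exact (Equiv.sumAssoc _ _ _).symm_apply_apply x
  | aInv_a => funext x; exact (Equiv.sumAssoc _ _ _).apply_symm_apply x
  | _ =>
    funext x
    repeat' first | rfl | rcases x with x | x

/-- The functor `G` to the category of functions between finite ordinals (the standard skeleton
of the category of finite sets): an object goes to the number of occurrences of `T` in it, and
an arrow to its graph. -/
def G (S : Type u) : LS S ⥤ FintypeCat.Skeleton.{0} where
  obj A := FintypeCat.Skeleton.mk (count A)
  map {A B} := Quotient.lift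
    (fun (f : Term A B) (i : ULift (Fin (count A))) =>
      ULift.up (number B (graph f ((number A).symm i.down))))
    (fun _ _ h => by rw [graph_eq h])
  map_id A := by
    funext i
    exact congrArg ULift.up ((number A).apply_symm_apply i.down)
  map_comp {A B C} := by
    rintro ⟨f⟩ ⟨g⟩
    funext i
    exact congrArg (fun x => ULift.up (number C (graph g x)))
      ((number B).symm_apply_apply (graph f ((number A).symm i.down))).symm

end LS

/-! Arrows are read as derivations of a sequent calculus. Its rules are identities on letters and on
the unit object, tensoring, composition with the unit of `T` (right rule for `T`), Kleisli extension
`ext` along a two-sided context `X ⊗ - ⊗ Y` (left rule for `T`), and precomposition with a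
structural arrow. Cut elimination (`Der.comp`) yields that every arrow is denoted by a cut-free
derivation (`der`).

Faithfulness is then an induction on a cut-free derivation of `f`: the graph forces any parallel `g`
with the same graph to end with the same rule. If `f` ends with the unit of `T`, its graph misses
the outermost `T` of the target, so `g` cannot be an extension. If `f` is an extension, its graph
sends the opened `T` to the outermost one, and then `g` is an extension at the same place
(`exists_eq_ext`), because extensions at two different places commute (`ext_twoHole`); this is where
the equality of the two composites `TA ⊗ TB ⟶ T(A ⊗ B)` enters. If `f` is a tensor, the graph and
the number of letters determine how the source splits (`Str.exists_tensor`). Structural arrows need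
no comparison, since parallel ones coincide (`Str.unique`). -/

namespace MonoidalMonad

variable {C : Type u} [Category.{v} C] [MonoidalCategory C] (M : MonoidalMonad C)

/-! ### Two-sided strength and Kleisli extension in a context -/

theorem ψL_whiskerRight (A B D : C) : M.ψL A B ▷ D ≫ M.ψL (A ⊗ B) D =
    (α_ (M.T.obj A) B D).hom ≫ M.ψL A (B ⊗ D) ≫ M.T.map (α_ A B D).inv := by
  have h := M.ψL_a A B D
  rw [tensorHom_id] at h
  rw [← reassoc_of% h, ← M.T.map_comp]
  simp

theorem ψR_whiskerRight (A B D : C) : M.ψR A B ▷ D ≫ M.ψL (A ⊗ B) D =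
    (α_ A (M.T.obj B) D).hom ≫ A ◁ M.ψL B D ≫ M.ψR A (B ⊗ D) ≫ M.T.map (α_ A B D).inv := by
  have h := M.ψLψR_a A B D
  rw [tensorHom_id, id_tensorHom] at h
  rw [← reassoc_of% h, ← M.T.map_comp]
  simp

theorem ψR_whiskerLeft (A B D : C) : A ◁ M.ψR B D ≫ M.ψR A (B ⊗ D) =
    (α_ A B (M.T.obj D)).inv ≫ M.ψR (A ⊗ B) D ≫ M.T.map (α_ A B D).hom := by
  have h := M.ψR_a A B D
  rw [id_tensorHom] at h
  simp [h]

theorem ψL_natural_right (A : C) {B B' : C} (g : B ⟶ B') :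
    M.T.obj A ◁ g ≫ M.ψL A B' = M.ψL A B ≫ M.T.map (A ◁ g) := by
  simpa using M.ψL_nat (𝟙 A) g

theorem ψR_natural_left {A A' : C} (f : A ⟶ A') (B : C) :
    f ▷ M.T.obj B ≫ M.ψR A' B = M.ψR A B ≫ M.T.map (f ▷ B) := by
  simpa using M.ψR_nat f (𝟙 B)

theorem ψR_natural_right (A : C) {B B' : C} (g : B ⟶ B') :
    A ◁ M.T.map g ≫ M.ψR A B' = M.ψR A B ≫ M.T.map (A ◁ g) := by
  simpa using M.ψR_nat (𝟙 A) g

/-- The unit of the monad, with its type unfolded. -/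
def ret (A : C) : A ⟶ M.T.obj A := M.T.η.app A

/-- The multiplication of the monad, with its type unfolded. -/
def mul (A : C) : M.T.obj (M.T.obj A) ⟶ M.T.obj A := M.T.μ.app A

theorem ret_natural {A B : C} (f : A ⟶ B) : f ≫ M.ret B = M.ret A ≫ M.T.map f :=
  M.T.η.naturality f

theorem mul_natural {A B : C} (f : A ⟶ B) :
    M.T.map (M.T.map f) ≫ M.mul B = M.mul A ≫ M.T.map f :=
  M.T.μ.naturality f

theorem map_mul (A : C) : M.T.map (M.mul A) ≫ M.mul A = M.mul (M.T.obj A) ≫ M.mul A :=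
  M.T.assoc A

@[simp]
theorem ret_mul (A : C) : M.ret (M.T.obj A) ≫ M.mul A = 𝟙 _ := M.T.left_unit A

@[simp]
theorem map_ret_mul (A : C) : M.T.map (M.ret A) ≫ M.mul A = 𝟙 _ := M.T.right_unit A

theorem ψL_ret (A B : C) : M.ret A ▷ B ≫ M.ψL A B = M.ret (A ⊗ B) := by
  rw [← tensorHom_id]; exact M.ψL_η A B

theorem ψR_ret (A B : C) : A ◁ M.ret B ≫ M.ψR A B = M.ret (A ⊗ B) := by
  rw [← id_tensorHom]; exact M.ψR_η A B

theorem ψL_mul (A B : C) : M.mul A ▷ B ≫ M.ψL A B =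
    M.ψL (M.T.obj A) B ≫ M.T.map (M.ψL A B) ≫ M.mul (A ⊗ B) := by
  rw [← tensorHom_id]; exact M.ψL_μ A B

theorem ψR_mul (A B : C) : A ◁ M.mul B ≫ M.ψR A B =
    M.ψR A (M.T.obj B) ≫ M.T.map (M.ψR A B) ≫ M.mul (A ⊗ B) := by
  rw [← id_tensorHom]; exact M.ψR_μ A B

theorem ψR_ψL_mul (A B : C) : M.ψR (M.T.obj A) B ≫ M.T.map (M.ψL A B) ≫ M.mul (A ⊗ B) =
    M.ψL A (M.T.obj B) ≫ M.T.map (M.ψR A B) ≫ M.mul (A ⊗ B) :=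
  M.ψLψR_μ A B

/-- The two-sided strength. -/
def st (X A Y : C) : X ⊗ M.T.obj A ⊗ Y ⟶ M.T.obj (X ⊗ A ⊗ Y) :=
  X ◁ M.ψL A Y ≫ M.ψR X (A ⊗ Y)

theorem st_eq (X A Y : C) : M.st X A Y = X ◁ M.ψL A Y ≫ M.ψR X (A ⊗ Y) := rfl

theorem st_natural {X X' A A' Y Y' : C} (x : X ⟶ X') (a : A ⟶ A') (y : Y ⟶ Y') :
    (x ⊗ₘ M.T.map a ⊗ₘ y) ≫ M.st X' A' Y' = M.st X A Y ≫ M.T.map (x ⊗ₘ a ⊗ₘ y) := by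
  have h : (x ⊗ₘ M.T.map a ⊗ₘ y) ≫ X' ◁ M.ψL A' Y' =
      X ◁ M.ψL A Y ≫ (x ⊗ₘ M.T.map (a ⊗ₘ y)) := by
    rw [← id_tensorHom, ← id_tensorHom, tensorHom_comp_tensorHom, tensorHom_comp_tensorHom,
      M.ψL_nat, Category.comp_id, Category.id_comp]
  rw [st, reassoc_of% h, M.ψR_nat, st, Category.assoc]

theorem ret_st (X A Y : C) : X ◁ M.ret A ▷ Y ≫ M.st X A Y = M.ret (X ⊗ A ⊗ Y) := by
  rw [st, ← whiskerLeft_comp_assoc, M.ψL_ret, M.ψR_ret]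

theorem mul_st (X A Y : C) : X ◁ M.mul A ▷ Y ≫ M.st X A Y =
    M.st X (M.T.obj A) Y ≫ M.T.map (M.st X A Y) ≫ M.mul (X ⊗ A ⊗ Y) := by
  rw [st, ← whiskerLeft_comp_assoc, M.ψL_mul, whiskerLeft_comp, whiskerLeft_comp, Category.assoc,
    Category.assoc, M.ψR_mul, st, reassoc_of% M.ψR_natural_right]
  simp

/-- The associativity isomorphism that moves a nested context out. -/
abbrev nest (X P Q R Y : C) : X ⊗ (P ⊗ Q ⊗ R) ⊗ Y ≅ (X ⊗ P) ⊗ Q ⊗ R ⊗ Y :=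
  whiskerLeftIso X (α_ P (Q ⊗ R) Y ≪≫ whiskerLeftIso P (α_ Q R Y)) ≪≫ (α_ X P (Q ⊗ R ⊗ Y)).symm

/-- Absorbing an inner context and then an outer one amounts to absorbing the merged context. The
inner `ψR` gets past the outer `ψL` by the mixed associativity equation. -/
theorem st_nest (X P Q R Y : C) : X ◁ M.st P Q R ▷ Y ≫ M.st X (P ⊗ Q ⊗ R) Y =
    (nest X P (M.T.obj Q) R Y).hom ≫ M.st (X ⊗ P) Q (R ⊗ Y) ≫ M.T.map (nest X P Q R Y).inv := by
  have h1 : M.st P Q R ▷ Y ≫ M.ψL (P ⊗ Q ⊗ R) Y =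
      (α_ P (M.T.obj Q ⊗ R) Y).hom ≫ P ◁ (α_ (M.T.obj Q) R Y).hom ≫ P ◁ M.ψL Q (R ⊗ Y) ≫
      M.ψR P (Q ⊗ R ⊗ Y) ≫ M.T.map (P ◁ (α_ Q R Y).inv ≫ (α_ P (Q ⊗ R) Y).inv) := by
    rw [st, comp_whiskerRight, Category.assoc, M.ψR_whiskerRight, whisker_assoc]
    simp only [Category.assoc, Iso.inv_hom_id_assoc]
    rw [← whiskerLeft_comp_assoc, M.ψL_whiskerRight]
    simp [reassoc_of% M.ψR_natural_right]
  rw [M.st_eq X, ← whiskerLeft_comp_assoc, h1]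
  simp only [whiskerLeft_comp, Category.assoc, M.ψR_natural_right, reassoc_of% M.ψR_whiskerLeft]
  simp [st]

/-- The Kleisli extension of an arrow along a two-sided context. -/
def ext {X A Y B : C} (f : X ⊗ A ⊗ Y ⟶ M.T.obj B) : X ⊗ M.T.obj A ⊗ Y ⟶ M.T.obj B :=
  M.st X A Y ≫ M.T.map f ≫ M.mul B

theorem ret_ext {X A Y B : C} (f : X ⊗ A ⊗ Y ⟶ M.T.obj B) :
    X ◁ M.ret A ▷ Y ≫ M.ext f = f := by
  rw [ext, reassoc_of% M.ret_st, ← reassoc_of% @ret_natural _ _ _ M]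
  simp

theorem ext_natural {X X' A A' Y Y' B : C} (x : X ⟶ X') (a : A ⟶ A') (y : Y ⟶ Y')
    (f : X' ⊗ A' ⊗ Y' ⟶ M.T.obj B) :
    (x ⊗ₘ M.T.map a ⊗ₘ y) ≫ M.ext f = M.ext ((x ⊗ₘ a ⊗ₘ y) ≫ f) := by
  rw [ext, reassoc_of% M.st_natural, ext, M.T.map_comp, Category.assoc]

theorem ext_context_natural {X X' A Y Y' B : C} (x : X ⟶ X') (y : Y ⟶ Y')
    (f : X' ⊗ A ⊗ Y' ⟶ M.T.obj B) :
    (x ⊗ₘ 𝟙 (M.T.obj A) ⊗ₘ y) ≫ M.ext f = M.ext ((x ⊗ₘ 𝟙 A ⊗ₘ y) ≫ f) := by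
  rw [← M.T.map_id, M.ext_natural]

theorem whiskerRight_ext {X X' A Y B : C} (x : X ⟶ X') (f : X' ⊗ A ⊗ Y ⟶ M.T.obj B) :
    x ▷ (M.T.obj A ⊗ Y) ≫ M.ext f = M.ext (x ▷ (A ⊗ Y) ≫ f) := by
  simpa using M.ext_context_natural x (𝟙 Y) f

theorem whiskerLeft_ext {X A Y Y' B : C} (y : Y ⟶ Y') (f : X ⊗ A ⊗ Y' ⟶ M.T.obj B) :
    X ◁ M.T.obj A ◁ y ≫ M.ext f = M.ext (X ◁ A ◁ y ≫ f) := by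
  simpa using M.ext_context_natural (𝟙 X) y f

/-- In cut elimination this permutes a cut above a left rule for `T` in its left premise. It
combines `st_nest` with associativity of the monad. -/
theorem ext_nest {X P Q R Y A B : C} (f : P ⊗ Q ⊗ R ⟶ M.T.obj A)
    (g : X ⊗ A ⊗ Y ⟶ M.T.obj B) :
    X ◁ M.ext f ▷ Y ≫ M.ext g = (nest X P (M.T.obj Q) R Y).hom ≫
      M.ext ((nest X P Q R Y).inv ≫ X ◁ f ▷ Y ≫ M.ext g) := by
  have h := M.st_natural (𝟙 X) f (𝟙 Y)
  simp only [id_tensorHom, tensorHom_id] at h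
  rw [ext, ext, comp_whiskerRight, comp_whiskerRight, whiskerLeft_comp, whiskerLeft_comp]
  simp only [Category.assoc, reassoc_of% M.mul_st, reassoc_of% h, reassoc_of% M.st_nest]
  rw [← reassoc_of% @mul_natural _ _ _ M]
  simp only [ext, M.T.map_comp, Category.assoc, M.map_mul]

/-- The last part `W` of the right context can be absorbed at the very end, by a single `ψL`. This
isolates the strength that has to be exchanged with a second hole in `W`. -/
theorem st_eq_ψL (X A Z W : C) : M.st X A (Z ⊗ W) =
    X ◁ (α_ _ _ _).inv ≫ (α_ X (M.T.obj A ⊗ Z) W).inv ≫ M.st X A Z ▷ W ≫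
      M.ψL (X ⊗ A ⊗ Z) W ≫ M.T.map ((α_ X (A ⊗ Z) W).hom ≫ X ◁ (α_ A Z W).hom) := by
  rw [M.st_eq X A Z, comp_whiskerRight, Category.assoc, reassoc_of% M.ψR_whiskerRight,
    whisker_assoc]
  simp only [Category.assoc, Iso.inv_hom_id_assoc, ← M.T.map_comp]
  rw [← whiskerLeft_comp_assoc X (M.ψL A Z ▷ W), M.ψL_whiskerRight, st]
  simp only [whiskerLeft_comp, Category.assoc, reassoc_of% M.ψR_natural_right, ← M.T.map_comp]
  simp

/-- The associativity isomorphism between the two bracketings of a context with two holes. -/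
abbrev twoHole (X U Z V Y : C) : X ⊗ U ⊗ Z ⊗ V ⊗ Y ≅ (X ⊗ U ⊗ Z) ⊗ V ⊗ Y :=
  whiskerLeftIso X (α_ U Z (V ⊗ Y)).symm ≪≫ (α_ X (U ⊗ Z) (V ⊗ Y)).symm

theorem st_eq_twoHole (X A Z V Y : C) : M.st X A (Z ⊗ V ⊗ Y) =
    (twoHole X (M.T.obj A) Z V Y).hom ≫ M.st X A Z ▷ (V ⊗ Y) ≫
      M.ψL (X ⊗ A ⊗ Z) (V ⊗ Y) ≫ M.T.map (twoHole X A Z V Y).inv := by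
  rw [st_eq_ψL]
  simp

/-- Once the context between the holes has been absorbed by the left hole, two adjacent `T`s remain
to be merged, and `ψR_ψL_mul` says that the order does not matter. -/
theorem st_twoHole (X A Z A' Y : C) :
    M.st X A (Z ⊗ M.T.obj A' ⊗ Y) ≫ M.T.map ((twoHole X A Z (M.T.obj A') Y).hom ≫
      M.st (X ⊗ A ⊗ Z) A' Y) ≫ M.mul _ =
    (twoHole X (M.T.obj A) Z (M.T.obj A') Y).hom ≫ M.st (X ⊗ M.T.obj A ⊗ Z) A' Y ≫
      M.T.map ((twoHole X (M.T.obj A) Z A' Y).inv ≫ M.st X A (Z ⊗ A' ⊗ Y) ≫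
        M.T.map (twoHole X A Z A' Y).hom) ≫ M.mul _ := by
  rw [st_eq_twoHole, st_eq_twoHole]
  simp only [Category.assoc, Iso.inv_hom_id_assoc, ← M.T.map_comp, Iso.inv_hom_id,
    ← M.T.map_comp_assoc, M.T.map_id, Category.comp_id]
  congr 1
  simp only [M.T.map_comp, Category.assoc, M.st_eq (X ⊗ A ⊗ Z), M.st_eq (X ⊗ M.T.obj A ⊗ Z)]
  rw [← reassoc_of% M.ψL_natural_right, ← M.ψR_ψL_mul, ← reassoc_of% M.ψR_natural_left,
    whisker_exchange_assoc]

theorem ret_twoHole_hom (X U Z A Y : C) :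
    X ◁ U ◁ Z ◁ M.ret A ▷ Y ≫ (twoHole X U Z (M.T.obj A) Y).hom =
      (twoHole X U Z A Y).hom ≫ (X ⊗ U ⊗ Z) ◁ M.ret A ▷ Y := by
  simp

theorem ret_twoHole_inv (X A Z V Y : C) :
    (X ◁ M.ret A ▷ Z) ▷ (V ⊗ Y) ≫ (twoHole X (M.T.obj A) Z V Y).inv =
      (twoHole X A Z V Y).inv ≫ X ◁ M.ret A ▷ (Z ⊗ V ⊗ Y) := by
  simp

/-- Left rules for `T` at two disjoint places permute: this is `st_twoHole` followed by the
extension of `k` to the target. -/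
theorem ext_twoHole {X A Z A' Y B : C} (k : X ⊗ A ⊗ Z ⊗ A' ⊗ Y ⟶ M.T.obj B) :
    (twoHole X (M.T.obj A) Z (M.T.obj A') Y).hom ≫
      M.ext ((twoHole X (M.T.obj A) Z A' Y).inv ≫ M.ext k) =
    M.ext ((twoHole X A Z (M.T.obj A') Y).hom ≫ M.ext ((twoHole X A Z A' Y).inv ≫ k)) := by
  have h := M.st_twoHole X A Z A' Y
  -- Writing `k` through the rebracketing lets `h` be postcomposed with the image of `k'`.
  have e : k = (twoHole X A Z A' Y).hom ≫ (twoHole X A Z A' Y).inv ≫ k := by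
    rw [Iso.hom_inv_id_assoc]
  generalize (twoHole X A Z A' Y).inv ≫ k = k' at e ⊢
  subst e
  have h' := h =≫ (M.T.map k' ≫ M.mul B)
  simpa only [ext, Category.assoc, M.T.map_comp, M.map_mul,
    reassoc_of% @mul_natural _ _ _ M] using h'.symm

theorem st_unit_left (A Y : C) :
    M.st (𝟙_ C) A Y = (λ_ _).hom ≫ M.ψL A Y ≫ M.T.map (λ_ _).inv := by
  have h := M.ψR_l (A ⊗ Y)
  rw [← leftUnitor_naturality_assoc, ← h, st]
  simp [← M.T.map_comp]

theorem ψL_unit (A : C) : M.ψL A (𝟙_ C) = (ρ_ _).hom ≫ M.T.map (ρ_ A).inv := by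
  rw [← M.ψL_r, Category.assoc, ← M.T.map_comp]
  simp

/-- Ordinary Kleisli extension is the case where both contexts are the unit object, on which the
strengths are trivial by `ψL_r` and `ψR_l`. -/
theorem map_comp_mul_eq_ext {A B : C} (h : A ⟶ M.T.obj B) : M.T.map h ≫ M.mul B =
    ((λ_ _).inv ≫ 𝟙_ C ◁ (ρ_ _).inv) ≫ M.ext ((𝟙_ C ◁ (ρ_ A).hom ≫ (λ_ A).hom) ≫ h) := by
  have e₁ : (λ_ (M.T.obj A)).inv ≫ 𝟙_ C ◁ (ρ_ _).inv ≫ (λ_ _).hom ≫ (ρ_ _).hom = 𝟙 _ := by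
    monoidal
  have e₂ : (ρ_ A).inv ≫ (λ_ _).inv ≫ 𝟙_ C ◁ (ρ_ _).hom ≫ (λ_ _).hom = 𝟙 _ := by
    monoidal
  rw [ext, st_unit_left, ψL_unit]
  simp only [Category.assoc, ← M.T.map_comp_assoc]
  rw [reassoc_of% e₁, reassoc_of% e₂]

/-- A strength is the extension of the unit of the monad, up to a unitor that fills the missing half
of the context; hence it is derivable. -/
theorem ψL_eq_ext (A B : C) : M.ψL A B =
    (λ_ _).inv ≫ M.ext ((λ_ (A ⊗ B)).hom ≫ M.ret (A ⊗ B)) := by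
  rw [ext, st_unit_left]
  simp

theorem ψR_eq_ext (A B : C) : M.ψR A B =
    A ◁ (ρ_ _).inv ≫ M.ext (A ◁ (ρ_ B).hom ≫ M.ret (A ⊗ B)) := by
  rw [ext, st_eq, ψL_unit, whiskerLeft_comp, Category.assoc, Category.assoc,
    reassoc_of% M.ψR_natural_right, M.T.map_comp, Category.assoc, map_ret_mul, Category.comp_id,
    ← M.T.map_comp, ← whiskerLeft_comp_assoc, ← whiskerLeft_comp]
  simp

end MonoidalMonad

/-! ### Coherence for structural arrows -/

namespace LS

variable {S : Type u}

/-- The atoms of the monoidal structure: letters and objects with outermost `T`. -/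
inductive Item (S : Type u) : Type u
  | letter : S → Item S
  | T : LS S → Item S

/-- An atom as an object. -/
def Item.obj : Item S → LS S
  | letter p => LS.letter p
  | T A => LS.T A

/-- The tensor product of a list of atoms, associated to the right. -/
def ofList : List (Item S) → LS S
  | [] => 𝟙_ (LS S)
  | i :: Γ => i.obj ⊗ ofList Γ

/-- The list of atoms of an object, followed by a given list. -/
def flat : LS S → List (Item S) → List (Item S)
  | letter p, Γ => .letter p :: Γ
  | unit, Γ => Γ
  | tensor A B, Γ => flat A (flat B Γ)
  | T A, Γ => .T A :: Γ

/-- The list of atoms of an object. -/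
def items (A : LS S) : List (Item S) := flat A []

theorem flat_eq (A : LS S) (Γ : List (Item S)) : flat A Γ = items A ++ Γ := by
  induction A generalizing Γ with
  | tensor A B ihA ihB =>
    change flat A (flat B Γ) = flat A (flat B []) ++ Γ
    rw [ihB, ihA, ihA (flat B []), List.append_assoc]
    rfl
  | _ => rfl

@[simp]
theorem items_tensor (A B : LS S) : items (A ⊗ B) = items A ++ items B := flat_eq A (items B)

@[simp]
theorem items_T (A : LS S) : items ((monoidalMonad S).T.obj A) = [.T A] := rfl

@[simp]
theorem items_ofList (Γ : List (Item S)) : items (ofList Γ) = Γ := by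
  induction Γ with
  | nil => rfl
  | cons i Γ ih =>
    rw [ofList, items_tensor, ih]
    cases i <;> rfl

/-- The isomorphism that brings an object to right-associated form. -/
def flatIso : ∀ (A : LS S) (Γ : List (Item S)), A ⊗ ofList Γ ≅ ofList (flat A Γ)
  | letter _, _ => Iso.refl _
  | unit, _ => λ_ _
  | tensor A B, Γ => α_ A B _ ≪≫ whiskerLeftIso A (flatIso B Γ) ≪≫ flatIso A (flat B Γ)
  | T _, _ => Iso.refl _

/-- Structural arrows: those built from the structure of a monoidal category. -/
inductive Str : ∀ {A B : LS S}, (A ⟶ B) → Prop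
  | id (A : LS S) : Str (𝟙 A)
  | comp {A B C : LS S} {f : A ⟶ B} {g : B ⟶ C} : Str f → Str g → Str (f ≫ g)
  | tensor {A A' B B' : LS S} {f : A ⟶ A'} {g : B ⟶ B'} : Str f → Str g → Str (f ⊗ₘ g)
  | α_hom (A B C : LS S) : Str (α_ A B C).hom
  | α_inv (A B C : LS S) : Str (α_ A B C).inv
  | l_hom (A : LS S) : Str (λ_ A).hom
  | l_inv (A : LS S) : Str (λ_ A).inv
  | r_hom (A : LS S) : Str (ρ_ A).hom
  | r_inv (A : LS S) : Str (ρ_ A).inv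

theorem Str.whiskerLeft (A : LS S) {B B' : LS S} {f : B ⟶ B'} (h : Str f) : Str (A ◁ f) := by
  rw [← id_tensorHom]; exact .tensor (.id A) h

theorem Str.whiskerRight (A : LS S) {B B' : LS S} {f : B ⟶ B'} (h : Str f) : Str (f ▷ A) := by
  rw [← tensorHom_id]; exact .tensor h (.id A)

theorem Str.exists_inv {A B : LS S} {f : A ⟶ B} (h : Str f) :
    ∃ g : B ⟶ A, Str g ∧ f ≫ g = 𝟙 A ∧ g ≫ f = 𝟙 B := by
  induction h with
  | id A => exact ⟨𝟙 A, .id A, by simp, by simp⟩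
  | comp _ _ ih₁ ih₂ =>
    obtain ⟨f', hf, h₁, h₂⟩ := ih₁
    obtain ⟨g', hg, h₃, h₄⟩ := ih₂
    exact ⟨g' ≫ f', .comp hg hf, by simp [reassoc_of% h₃, h₁], by simp [reassoc_of% h₂, h₄]⟩
  | tensor _ _ ih₁ ih₂ =>
    obtain ⟨f', hf, h₁, h₂⟩ := ih₁
    obtain ⟨g', hg, h₃, h₄⟩ := ih₂
    exact ⟨f' ⊗ₘ g', .tensor hf hg, by simp [h₁, h₃], by simp [h₂, h₄]⟩
  | α_hom A B C => exact ⟨_, .α_inv A B C, by simp, by simp⟩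
  | α_inv A B C => exact ⟨_, .α_hom A B C, by simp, by simp⟩
  | l_hom A => exact ⟨_, .l_inv A, by simp, by simp⟩
  | l_inv A => exact ⟨_, .l_hom A, by simp, by simp⟩
  | r_hom A => exact ⟨_, .r_inv A, by simp, by simp⟩
  | r_inv A => exact ⟨_, .r_hom A, by simp, by simp⟩

theorem Str.eqToHom {A B : LS S} (h : A = B) : Str (eqToHom h) := by
  subst h; exact .id _

theorem Str.flatIso_hom (A : LS S) (Γ : List (Item S)) : Str (flatIso A Γ).hom := by
  induction A generalizing Γ with
  | unit => exact .l_hom _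
  | tensor A B ihA ihB =>
    exact .comp (.α_hom _ _ _) (.comp (.whiskerLeft _ (ihB _)) (ihA _))
  | _ => exact .id _

/-- Both objects are isomorphic, through structural arrows, to the right-associated tensor of their
common list of atoms. -/
theorem Str.exists_of_items_eq {A B : LS S} (h : items A = items B) : ∃ f : A ⟶ B, Str f := by
  obtain ⟨g, hg, -⟩ := (Str.comp (.r_inv B) (.flatIso_hom B [])).exists_inv
  exact ⟨_, .comp (.comp (.r_inv A) (.flatIso_hom A []))
    (.comp (.eqToHom (congrArg ofList h)) hg)⟩

theorem flatIso_naturality (A : LS S) {Γ Δ : List (Item S)} (h : Γ = Δ) :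
    A ◁ eqToHom (congrArg ofList h) ≫ (flatIso A Δ).hom =
      (flatIso A Γ).hom ≫ eqToHom (congrArg (fun Γ => ofList (flat A Γ)) h) := by
  subst h; simp

theorem flatIso_unit_right (A : LS S) (Γ : List (Item S)) :
    (ρ_ A).hom ▷ ofList Γ ≫ (flatIso A Γ).hom = (flatIso (A ⊗ 𝟙_ (LS S)) Γ).hom :=
  (triangle_assoc A (ofList Γ) (flatIso A Γ).hom).symm

theorem flatIso_unit_left (A : LS S) (Γ : List (Item S)) :
    (λ_ A).hom ▷ ofList Γ ≫ (flatIso A Γ).hom = (flatIso (𝟙_ (LS S) ⊗ A) Γ).hom := by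
  -- `flatIso` unfolds to this shape by definition; with an arbitrary arrow in its place, a plain
  -- identity of monoidal categories is left.
  have h {P : LS S} (a : A ⊗ ofList Γ ⟶ P) : (λ_ A).hom ▷ ofList Γ ≫ a =
      (α_ _ _ _).hom ≫ 𝟙_ (LS S) ◁ a ≫ (λ_ P).hom := by
    simp
  exact h _

theorem flatIso_assoc (A B C : LS S) (Γ : List (Item S)) :
    (α_ A B C).hom ▷ ofList Γ ≫ (flatIso (A ⊗ B ⊗ C) Γ).hom =
      (flatIso ((A ⊗ B) ⊗ C) Γ).hom := by
  have h {P Q R : LS S} (c : C ⊗ ofList Γ ⟶ P) (b : B ⊗ P ⟶ Q) (a : A ⊗ Q ⟶ R) :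
      (α_ A B C).hom ▷ ofList Γ ≫ (α_ _ _ _).hom ≫ A ◁ ((α_ _ _ _).hom ≫ B ◁ c ≫ b) ≫ a =
        (α_ _ _ _).hom ≫ (A ⊗ B) ◁ c ≫ (α_ _ _ _).hom ≫ A ◁ b ≫ a := by
    simp
  exact h _ _ _

/-- In right-associated form every structural arrow becomes a transport along an equality of lists.
Such a transport does not depend on the arrow, which gives coherence; the equality itself says that
atoms are neither moved nor changed. -/
theorem Str.comp_flatIso {A B : LS S} {s : A ⟶ B} (hs : Str s) (Γ : List (Item S)) :
    ∃ h : flat A Γ = flat B Γ,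
      s ▷ ofList Γ ≫ (flatIso B Γ).hom = (flatIso A Γ).hom ≫ CategoryTheory.eqToHom
        (congrArg ofList h) := by
  induction hs generalizing Γ with
  | id => exact ⟨rfl, by simp⟩
  | comp _ _ ih₁ ih₂ =>
    obtain ⟨h₁, e₁⟩ := ih₁ Γ
    obtain ⟨h₂, e₂⟩ := ih₂ Γ
    exact ⟨h₁.trans h₂, by simp [e₂, reassoc_of% e₁]⟩
  | @tensor A A' B B' f g _ _ ih₁ ih₂ =>
    obtain ⟨h₂, e₂⟩ := ih₂ Γ
    obtain ⟨h₁, e₁⟩ := ih₁ (flat B Γ)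
    have h : flat A (flat B Γ) = flat A' (flat B' Γ) := by rw [h₁, h₂]
    refine ⟨h, ?_⟩
    change (f ⊗ₘ g) ▷ ofList Γ ≫ (α_ _ _ _).hom ≫ A' ◁ (flatIso B' Γ).hom ≫
      (flatIso A' (flat B' Γ)).hom = ((α_ _ _ _).hom ≫ A ◁ (flatIso B Γ).hom ≫
        (flatIso A (flat B Γ)).hom) ≫ CategoryTheory.eqToHom (congrArg ofList h)
    rw [MonoidalCategory.tensorHom_def]
    simp only [comp_whiskerRight, whisker_assoc, Category.assoc, Iso.inv_hom_id_assoc]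
    rw [← whiskerLeft_comp_assoc, e₂, whiskerLeft_comp, Category.assoc,
      flatIso_naturality A' h₂, associator_naturality_left_assoc, ← whisker_exchange_assoc,
      reassoc_of% e₁]
    simp
  | α_hom A B C => exact ⟨rfl, (flatIso_assoc A B C Γ).trans (Category.comp_id _).symm⟩
  | α_inv A B C =>
    exact ⟨rfl, ((Iso.inv_comp_eq (whiskerRightIso (α_ A B C) (ofList Γ))).2
      (flatIso_assoc A B C Γ).symm).trans (Category.comp_id _).symm⟩
  | l_hom A => exact ⟨rfl, (flatIso_unit_left A Γ).trans (Category.comp_id _).symm⟩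
  | l_inv A =>
    exact ⟨rfl, ((Iso.inv_comp_eq (whiskerRightIso (λ_ A) (ofList Γ))).2
      (flatIso_unit_left A Γ).symm).trans (Category.comp_id _).symm⟩
  | r_hom A => exact ⟨rfl, (flatIso_unit_right A Γ).trans (Category.comp_id _).symm⟩
  | r_inv A =>
    exact ⟨rfl, ((Iso.inv_comp_eq (whiskerRightIso (ρ_ A) (ofList Γ))).2
      (flatIso_unit_right A Γ).symm).trans (Category.comp_id _).symm⟩

theorem Str.items_eq {A B : LS S} {s : A ⟶ B} (hs : Str s) : items A = items B :=
  (hs.comp_flatIso []).1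

/-- Coherence: parallel structural arrows are equal. -/
theorem Str.unique {A B : LS S} {s t : A ⟶ B} (hs : Str s) (ht : Str t) : s = t := by
  obtain ⟨_, e₁⟩ := hs.comp_flatIso []
  obtain ⟨_, e₂⟩ := ht.comp_flatIso []
  have e : s ▷ 𝟙_ (LS S) = t ▷ 𝟙_ (LS S) := (cancel_mono (flatIso B []).hom).1 (e₁.trans e₂.symm)
  rwa [whiskerRight_iff] at e

-- Cut-free derivations and cut elimination

local notation "𝐌" => monoidalMonad

/-- Arrows denoted by cut-free derivations. -/
inductive Der : ∀ {A B : LS S}, (A ⟶ B) → Prop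
  | letter (p : S) : Der (𝟙 (letter p))
  | unit : Der (𝟙 (𝟙_ (LS S)))
  | tensor {A A' B B' : LS S} {f : A ⟶ A'} {g : B ⟶ B'} : Der f → Der g → Der (f ⊗ₘ g)
  | ret {A B : LS S} {f : A ⟶ B} : Der f → Der (f ≫ (𝐌 S).ret B)
  | ext {X A Y B : LS S} {f : X ⊗ A ⊗ Y ⟶ (𝐌 S).T.obj B} : Der f → Der ((𝐌 S).ext f)
  | str {A' A B : LS S} {s : A' ⟶ A} {f : A ⟶ B} : Str s → Der f → Der (s ≫ f)

/-- The form of a cut-free derivation, according to its target. -/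
def CutFreeForm : ∀ {A : LS S} (B : LS S), (A ⟶ B) → Prop
  | _, LS.letter _, f => Str f
  | _, LS.unit, f => Str f
  | A, LS.tensor B₁ B₂, f => ∃ (A₁ A₂ : LS S) (s : A ⟶ A₁ ⊗ A₂) (f₁ : A₁ ⟶ B₁) (f₂ : A₂ ⟶ B₂),
      Str s ∧ Der f₁ ∧ Der f₂ ∧ f = s ≫ (f₁ ⊗ₘ f₂)
  | A, LS.T B, f => (∃ f' : A ⟶ B, Der f' ∧ f = f' ≫ (𝐌 S).ret B) ∨
      ∃ (X Q Y : LS S) (s : A ⟶ X ⊗ (𝐌 S).T.obj Q ⊗ Y) (f' : X ⊗ Q ⊗ Y ⟶ (𝐌 S).T.obj B),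
        Str s ∧ f = s ≫ (𝐌 S).ext f'

theorem Der.cutFreeForm {A B : LS S} {f : A ⟶ B} (h : Der f) : CutFreeForm B f := by
  induction h with
  | letter p => exact Str.id _
  | unit => exact Str.id _
  | tensor hf hg => exact ⟨_, _, _, _, _, .id _, hf, hg, (Category.id_comp _).symm⟩
  | ret hf => exact .inl ⟨_, hf, rfl⟩
  | ext hf => exact .inr ⟨_, _, _, _, _, .id _, (Category.id_comp _).symm⟩
  | @str A' A B s f hs hf ih =>
    cases B with
    | letter p => exact hs.comp ih
    | unit => exact hs.comp ih
    | tensor B₁ B₂ =>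
      obtain ⟨A₁, A₂, t, f₁, f₂, ht, h₁, h₂, rfl⟩ := ih
      exact ⟨A₁, A₂, s ≫ t, f₁, f₂, hs.comp ht, h₁, h₂, (Category.assoc _ _ _).symm⟩
    | T B =>
      obtain ⟨f', hf', rfl⟩ | ⟨X, Q, Y, t, f', ht, rfl⟩ := ih
      · exact .inl ⟨s ≫ f', .str hs hf', (Category.assoc _ _ _).symm⟩
      · exact .inr ⟨X, Q, Y, s ≫ t, f', hs.comp ht, (Category.assoc _ _ _).symm⟩

theorem Der.str_of_unit {A : LS S} {f : A ⟶ 𝟙_ (LS S)} (h : Der f) : Str f := h.cutFreeForm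

theorem Der.exists_of_tensor {A B₁ B₂ : LS S} {f : A ⟶ B₁ ⊗ B₂} (h : Der f) :
    ∃ (A₁ A₂ : LS S) (s : A ⟶ A₁ ⊗ A₂) (f₁ : A₁ ⟶ B₁) (f₂ : A₂ ⟶ B₂),
      Str s ∧ Der f₁ ∧ Der f₂ ∧ f = s ≫ (f₁ ⊗ₘ f₂) := h.cutFreeForm

/-- Structural arrows are a rule on the source only; on the target they are pushed back through the
tensor rules. A factor with target the unit object is itself structural, so it can be absorbed. -/
theorem Der.comp_str {A B C : LS S} {f : A ⟶ B} {s : B ⟶ C} (hf : Der f) (hs : Str s) :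
    Der (f ≫ s) := by
  induction hs generalizing A with
  | id => simpa using hf
  | comp _ _ ih₁ ih₂ => simpa using ih₂ (ih₁ hf)
  | tensor _ _ ih₁ ih₂ =>
    obtain ⟨A₁, A₂, t, f₁, f₂, ht, h₁, h₂, rfl⟩ := hf.exists_of_tensor
    rw [Category.assoc, tensorHom_comp_tensorHom]
    exact .str ht (.tensor (ih₁ h₁) (ih₂ h₂))
  | α_hom =>
    obtain ⟨A₁, A₂, t, f₁, f₂, ht, h₁, h₂, rfl⟩ := hf.exists_of_tensor
    obtain ⟨A₃, A₄, t', f₃, f₄, ht', h₃, h₄, rfl⟩ := h₁.exists_of_tensor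
    have e : (t ≫ ((t' ≫ (f₃ ⊗ₘ f₄)) ⊗ₘ f₂)) ≫ (α_ _ _ _).hom =
        (t ≫ (t' ⊗ₘ 𝟙 A₂) ≫ (α_ _ _ _).hom) ≫ (f₃ ⊗ₘ f₄ ⊗ₘ f₂) := by
      simp only [Category.assoc, ← associator_naturality, tensorHom_comp_tensorHom_assoc,
        Category.id_comp]
    rw [e]
    exact .str (ht.comp (.comp (.tensor ht' (.id _)) (.α_hom _ _ _))) (.tensor h₃ (.tensor h₄ h₂))
  | α_inv =>
    obtain ⟨A₁, A₂, t, f₁, f₂, ht, h₁, h₂, rfl⟩ := hf.exists_of_tensor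
    obtain ⟨A₃, A₄, t', f₃, f₄, ht', h₃, h₄, rfl⟩ := h₂.exists_of_tensor
    have e : (t ≫ (f₁ ⊗ₘ (t' ≫ (f₃ ⊗ₘ f₄)))) ≫ (α_ _ _ _).inv =
        (t ≫ (𝟙 A₁ ⊗ₘ t') ≫ (α_ _ _ _).inv) ≫ ((f₁ ⊗ₘ f₃) ⊗ₘ f₄) := by
      simp only [Category.assoc, ← associator_inv_naturality, tensorHom_comp_tensorHom_assoc,
        Category.id_comp]
    rw [e]
    exact .str (ht.comp (.comp (.tensor (.id _) ht') (.α_inv _ _ _))) (.tensor (.tensor h₁ h₃) h₄)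
  | l_hom =>
    obtain ⟨A₁, A₂, t, f₁, f₂, ht, h₁, h₂, rfl⟩ := hf.exists_of_tensor
    have e : (t ≫ (f₁ ⊗ₘ f₂)) ≫ (λ_ _).hom = (t ≫ (f₁ ⊗ₘ 𝟙 A₂) ≫ (λ_ _).hom) ≫ f₂ := by
      simp [MonoidalCategory.tensorHom_def]
    rw [e]
    exact .str (ht.comp (.comp (.tensor h₁.str_of_unit (.id _)) (.l_hom _))) h₂
  | l_inv =>
    rw [leftUnitor_inv_naturality, ← id_tensorHom]
    exact .str (.l_inv _) (.tensor .unit hf)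
  | r_hom =>
    obtain ⟨A₁, A₂, t, f₁, f₂, ht, h₁, h₂, rfl⟩ := hf.exists_of_tensor
    have e : (t ≫ (f₁ ⊗ₘ f₂)) ≫ (ρ_ _).hom = (t ≫ (𝟙 A₁ ⊗ₘ f₂) ≫ (ρ_ _).hom) ≫ f₁ := by
      simp [MonoidalCategory.tensorHom_def']
    rw [e]
    exact .str (ht.comp (.comp (.tensor (.id _) h₂.str_of_unit) (.r_hom _))) h₁
  | r_inv =>
    rw [rightUnitor_inv_naturality, ← tensorHom_id]
    exact .str (.r_inv _) (.tensor hf .unit)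

theorem Str.nest_hom (X P Q R Y : LS S) : Str (MonoidalMonad.nest X P Q R Y).hom :=
  .comp (.whiskerLeft _ (.comp (.α_hom _ _ _) (.whiskerLeft _ (.α_hom _ _ _)))) (.α_inv _ _ _)

theorem Str.nest_inv (X P Q R Y : LS S) : Str (MonoidalMonad.nest X P Q R Y).inv :=
  .comp (.α_hom _ _ _) (.whiskerLeft _ (.comp (.whiskerLeft _ (.α_inv _ _ _)) (.α_inv _ _ _)))

/-- Isolates the arrow `f` that is cut against the opened `T`; the arrows on the context slide
inside the extension. -/
theorem tensor_comp_ext {X X' A Y Y' B Q : LS S} (x : X ⟶ X') (f : A ⟶ (𝐌 S).T.obj Q) (y : Y ⟶ Y')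
    (g : X' ⊗ Q ⊗ Y' ⟶ (𝐌 S).T.obj B) : (x ⊗ₘ f ⊗ₘ y) ≫ (𝐌 S).ext g =
      X ◁ f ▷ Y ≫ (𝐌 S).ext ((x ⊗ₘ 𝟙 Q ⊗ₘ y) ≫ g) := by
  have e : (x ⊗ₘ f ⊗ₘ y) = X ◁ f ▷ Y ≫ (x ⊗ₘ 𝟙 _ ⊗ₘ y) := by
    simp only [← id_tensorHom, ← tensorHom_id, tensorHom_comp_tensorHom, Category.id_comp,
      Category.comp_id]
  rw [e, Category.assoc, MonoidalMonad.ext_context_natural]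

/-- Composites of an arrow, put in a context, with Kleisli extensions are cut-free. -/
def CutIntoExt : ∀ {A : LS S} (B : LS S), (A ⟶ B) → Prop
  | A, LS.T Q, f => ∀ {X X' Y Y' B : LS S} {x : X ⟶ X'} {y : Y ⟶ Y'}
      {g : X' ⊗ Q ⊗ Y' ⟶ (𝐌 S).T.obj B}, Der x → Der y →
      (∀ {D : LS S} {h : D ⟶ X' ⊗ Q ⊗ Y'}, Der h → Der (h ≫ g)) →
      Der ((x ⊗ₘ (show A ⟶ (𝐌 S).T.obj Q from f) ⊗ₘ y) ≫ (𝐌 S).ext g)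
  | _, _, _ => True

/-- This is the inner induction of cut elimination, on the left premise. The closure hypothesis on
`g` is what the outer induction on the right premise supplies. -/
theorem Der.cutIntoExt {A B : LS S} {f : A ⟶ B} (h : Der f) : CutIntoExt B f := by
  induction h with
  | letter p => trivial
  | unit => trivial
  | tensor => trivial
  | @ret A Q f hf _ =>
    intro X X' Y Y' B x y g hx hy hg
    -- Principal cut: the right rule for `T` meets the left rule and both disappear by `ret_ext`.
    have e : (x ⊗ₘ (f ≫ (𝐌 S).ret Q) ⊗ₘ y) ≫ (𝐌 S).ext g = (x ⊗ₘ f ⊗ₘ y) ≫ g := by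
      rw [tensor_comp_ext, comp_whiskerRight, whiskerLeft_comp, Category.assoc,
        MonoidalMonad.ret_ext, ← Category.assoc]
      simp only [← id_tensorHom, ← tensorHom_id, tensorHom_comp_tensorHom, Category.id_comp,
        Category.comp_id]
    exact e ▸ hg (.tensor hx (.tensor hf hy))
  | @ext P K R Q f hf ih =>
    intro X X' Y Y' B x y g hx hy hg
    have e : (x ⊗ₘ (𝐌 S).ext f ⊗ₘ y) ≫ (𝐌 S).ext g = (MonoidalMonad.nest X P _ R Y).hom ≫
        (𝐌 S).ext ((MonoidalMonad.nest X P K R Y).inv ≫ (x ⊗ₘ f ⊗ₘ y) ≫ (𝐌 S).ext g) := by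
      rw [tensor_comp_ext, MonoidalMonad.ext_nest, tensor_comp_ext]
    exact e ▸ .str (.nest_hom _ _ _ _ _) (.ext (.str (.nest_inv _ _ _ _ _) (ih hx hy hg)))
  | @str A' A Q s f hs hf ih =>
    cases Q with
    | T Q =>
      intro X X' Y Y' B x y g hx hy hg
      have e (f : A ⟶ (𝐌 S).T.obj Q) : (x ⊗ₘ (s ≫ f) ⊗ₘ y) ≫ (𝐌 S).ext g =
          X ◁ s ▷ Y ≫ (x ⊗ₘ f ⊗ₘ y) ≫ (𝐌 S).ext g := by
        rw [tensor_comp_ext, tensor_comp_ext]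
        simp
      exact e f ▸ .str (.whiskerLeft _ (.whiskerRight _ hs)) (ih hx hy hg)
    | _ => trivial

/-- Cut elimination. -/
theorem Der.comp {A B C : LS S} {f : A ⟶ B} {g : B ⟶ C} (hf : Der f) (hg : Der g) :
    Der (f ≫ g) := by
  induction hg generalizing A with
  | letter | unit => simpa using hf
  | tensor _ _ ih₁ ih₂ =>
    obtain ⟨A₁, A₂, t, f₁, f₂, ht, h₁, h₂, rfl⟩ := hf.exists_of_tensor
    rw [Category.assoc, tensorHom_comp_tensorHom]
    exact .str ht (.tensor (ih₁ h₁) (ih₂ h₂))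
  | ret _ ih =>
    rw [← Category.assoc]
    exact .ret (ih hf)
  | ext _ ih =>
    obtain ⟨A₁, A₂, t, f₁, f₂, ht, h₁, h₂, rfl⟩ := hf.exists_of_tensor
    obtain ⟨A₃, A₄, t', f₃, f₄, ht', h₃, h₄, rfl⟩ := h₂.exists_of_tensor
    have e : f₁ ⊗ₘ (t' ≫ (f₃ ⊗ₘ f₄)) = A₁ ◁ t' ≫ (f₁ ⊗ₘ f₃ ⊗ₘ f₄) := by
      simp only [← id_tensorHom, tensorHom_comp_tensorHom, Category.id_comp]
    rw [e, Category.assoc, Category.assoc]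
    -- Here `ih` is admissibility of cuts with the premise of the left rule.
    exact .str ht (.str (.whiskerLeft _ ht') (h₃.cutIntoExt h₁ h₄ ih))
  | str hs _ ih =>
    rw [← Category.assoc]
    exact ih (hf.comp_str hs)

theorem Der.map_comp_mul {A B : LS S} {f : A ⟶ (𝐌 S).T.obj B} (hf : Der f) :
    Der ((𝐌 S).T.map f ≫ (𝐌 S).mul B) := by
  rw [MonoidalMonad.map_comp_mul_eq_ext]
  exact .str (.comp (.l_inv _) (.whiskerLeft _ (.r_inv _)))
    (.ext (.str (.comp (.whiskerLeft _ (.r_hom _)) (.l_hom _)) hf))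

theorem Der.map {A B : LS S} {f : A ⟶ B} (hf : Der f) : Der ((𝐌 S).T.map f) := by
  have h := hf.ret.map_comp_mul
  rwa [Functor.map_comp, Category.assoc, MonoidalMonad.map_ret_mul, Category.comp_id] at h

/-- The calculus has identities only at letters and at the unit object; the others are expanded
along the object. -/
theorem Der.id (A : LS S) : Der (𝟙 A) := by
  induction A with
  | letter p => exact .letter p
  | unit => exact .unit
  | tensor A B ihA ihB => exact id_tensorHom_id A B ▸ ihA.tensor ihB
  | T A ih => exact (𝐌 S).T.map_id A ▸ ih.map

theorem Str.der {A B : LS S} {s : A ⟶ B} (hs : Str s) : Der s :=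
  Category.comp_id s ▸ .str hs (.id B)

theorem der_arrow {A B : LS S} (f : Term A B) : Der f.arrow := by
  induction f with
  | one A => exact .id A
  | comp f g ihf ihg => exact ihf.comp ihg
  | tensor f g ihf ihg => exact ihf.tensor ihg
  | map f ih => exact ih.map
  | a A B C => exact (Str.α_hom A B C).der
  | aInv A B C => exact (Str.α_inv A B C).der
  | l A => exact (Str.l_hom A).der
  | lInv A => exact (Str.l_inv A).der
  | r A => exact (Str.r_hom A).der
  | rInv A => exact (Str.r_inv A).der
  | η A =>
    have h : Der ((𝐌 S).ret A) := Category.id_comp ((𝐌 S).ret A) ▸ (Der.id A).ret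
    exact h
  | μ A =>
    have h := (Der.id ((𝐌 S).T.obj A)).map_comp_mul
    rw [CategoryTheory.Functor.map_id, Category.id_comp] at h
    exact h
  | ψL A B =>
    have h : Der ((𝐌 S).ψL A B) := by
      rw [MonoidalMonad.ψL_eq_ext]
      exact .str (.l_inv _) (.ext (.ret (Str.l_hom _).der))
    exact h
  | ψR A B =>
    have h : Der ((𝐌 S).ψR A B) := by
      rw [MonoidalMonad.ψR_eq_ext]
      exact .str (.whiskerLeft _ (.r_inv _)) (.ext (.ret ((Str.r_hom _).whiskerLeft _).der))
    exact h

theorem der {A B : LS S} (f : A ⟶ B) : Der f := by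
  obtain ⟨f⟩ := f
  exact der_arrow f

/-! ### Graphs of arrows -/

/-- The graph of an arrow. -/
def gr {A B : LS S} : (A ⟶ B) → Occ A → Occ B := Quotient.lift graph fun _ _ h => graph_eq h

/-- The outermost occurrence of `T`. -/
def root {A : LS S} : Occ ((𝐌 S).T.obj A) := none

/-- An occurrence below the outermost `T`. -/
def inT {A : LS S} (x : Occ A) : Occ ((𝐌 S).T.obj A) := some x

/-- An occurrence in the left factor. -/
def inL {A B : LS S} (x : Occ A) : Occ (A ⊗ B) := Sum.inl x

/-- An occurrence in the right factor. -/
def inR {A B : LS S} (x : Occ B) : Occ (A ⊗ B) := Sum.inr x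

theorem inT_ne_root {A : LS S} (x : Occ A) : inT x ≠ root := Option.some_ne_none x

theorem inT_injective {A : LS S} : Function.Injective (inT (A := A)) := Option.some_injective _

theorem inL_injective {A B : LS S} : Function.Injective (inL (A := A) (B := B)) :=
  Sum.inl_injective

theorem inR_injective {A B : LS S} : Function.Injective (inR (A := A) (B := B)) :=
  Sum.inr_injective

theorem inL_ne_inR {A B : LS S} (x : Occ A) (y : Occ B) : inL x ≠ inR y := Sum.inl_ne_inr

@[simp]
theorem gr_id (A : LS S) (x : Occ A) : gr (𝟙 A) x = x := rfl

@[simp]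
theorem gr_comp {A B C : LS S} (f : A ⟶ B) (g : B ⟶ C) (x : Occ A) :
    gr (f ≫ g) x = gr g (gr f x) := by
  obtain ⟨f⟩ := f
  obtain ⟨g⟩ := g
  rfl

@[simp]
theorem gr_tensorHom_inL {A A' B B' : LS S} (f : A ⟶ A') (g : B ⟶ B') (x : Occ A) :
    gr (f ⊗ₘ g) (inL x) = inL (gr f x) := by
  obtain ⟨f⟩ := f
  obtain ⟨g⟩ := g
  rfl

@[simp]
theorem gr_tensorHom_inR {A A' B B' : LS S} (f : A ⟶ A') (g : B ⟶ B') (x : Occ B) :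
    gr (f ⊗ₘ g) (inR x) = inR (gr g x) := by
  obtain ⟨f⟩ := f
  obtain ⟨g⟩ := g
  rfl

@[simp]
theorem gr_whiskerLeft_inL (A : LS S) {B B' : LS S} (g : B ⟶ B') (x : Occ A) :
    gr (A ◁ g) (inL x) = inL x := by
  rw [← id_tensorHom, gr_tensorHom_inL, gr_id]

@[simp]
theorem gr_whiskerLeft_inR (A : LS S) {B B' : LS S} (g : B ⟶ B') (x : Occ B) :
    gr (A ◁ g) (inR x) = inR (gr g x) := by
  rw [← id_tensorHom, gr_tensorHom_inR]

@[simp]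
theorem gr_whiskerRight_inL {A A' : LS S} (f : A ⟶ A') (B : LS S) (x : Occ A) :
    gr (f ▷ B) (inL x) = inL (gr f x) := by
  rw [← tensorHom_id, gr_tensorHom_inL]

@[simp]
theorem gr_whiskerRight_inR {A A' : LS S} (f : A ⟶ A') (B : LS S) (x : Occ B) :
    gr (f ▷ B) (inR x) = inR x := by
  rw [← tensorHom_id, gr_tensorHom_inR, gr_id]

theorem gr_associator_inv_inR_inL (A B C : LS S) (x : Occ B) :
    gr (α_ A B C).inv (inR (inL x)) = inL (inR x) := rfl

theorem gr_map_root {A B : LS S} (f : A ⟶ B) : gr ((𝐌 S).T.map f) root = root := by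
  obtain ⟨f⟩ := f
  rfl

theorem gr_ret (A : LS S) (x : Occ A) : gr ((𝐌 S).ret A) x = inT x := rfl

theorem gr_ext_root {X A Y B : LS S} (f : X ⊗ A ⊗ Y ⟶ (𝐌 S).T.obj B) :
    gr ((𝐌 S).ext f) (inR (inL root)) = root := by
  have h₁ : gr ((𝐌 S).st X A Y) (inR (inL root)) = root := by
    rw [MonoidalMonad.st_eq, gr_comp, gr_whiskerLeft_inR]
    rfl
  have h₂ : gr ((𝐌 S).mul B) root = root := rfl
  rw [MonoidalMonad.ext, gr_comp, gr_comp, h₁, gr_map_root, h₂]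

/-! ### Inverting the left rule for `T` from the graph -/

theorem Str.twoHole_hom (X U Z V Y : LS S) : Str (MonoidalMonad.twoHole X U Z V Y).hom :=
  .comp (.whiskerLeft _ (.α_inv _ _ _)) (.α_inv _ _ _)

theorem Str.twoHole_inv (X U Z V Y : LS S) : Str (MonoidalMonad.twoHole X U Z V Y).inv :=
  .comp (.α_hom _ _ _) (.whiskerLeft _ (.α_hom _ _ _))

/-- Here the marked `T A` lies to the left of the `T A'` opened last. The premise `h` is an
extension at the marked place by `ih`, and the two extensions are exchanged by `ext_twoHole`. -/
theorem exists_ext_of_left {X A Z A' X' Y Y' B : LS S}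
    {s : X ⊗ (𝐌 S).T.obj A ⊗ Y ⟶ X' ⊗ (𝐌 S).T.obj A' ⊗ Y'} (hs : Str s)
    {h : X' ⊗ A' ⊗ Y' ⟶ (𝐌 S).T.obj B}
    (hX : items (X ⊗ (𝐌 S).T.obj A ⊗ Z) = items X')
    (hY : items Y = items (Z ⊗ (𝐌 S).T.obj A' ⊗ Y'))
    (hg : gr (s ≫ (𝐌 S).ext h) (inR (inL root)) = root)
    (ih : ∀ {P R : LS S} {t : P ⊗ (𝐌 S).T.obj A ⊗ R ⟶ X' ⊗ A' ⊗ Y'}, Str t →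
      gr (t ≫ h) (inR (inL root)) = root → ∃ k, t ≫ h = (𝐌 S).ext k) :
    ∃ k, s ≫ (𝐌 S).ext h = (𝐌 S).ext k := by
  obtain ⟨u, hu⟩ := Str.exists_of_items_eq hX
  obtain ⟨v, hv⟩ := Str.exists_of_items_eq hY
  obtain ⟨v', hv', -, hvv⟩ := hv.exists_inv
  -- By coherence `s` may be replaced by a rebracketing that displays both holes.
  obtain rfl := hs.unique (.comp (hv.whiskerLeft _ |>.whiskerLeft X)
    (.comp (.twoHole_hom _ _ _ _ _) (hu.whiskerRight _)))
  -- Filling the hole `T A'` with the unit of `T` recovers `h`. This does not move the marked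
  -- occurrence, so the graph condition passes to the premise.
  have eh : ((MonoidalMonad.twoHole X ((𝐌 S).T.obj A) Z A' Y').hom ≫ u ▷ (A' ⊗ Y')) ≫ h =
      X ◁ (𝐌 S).T.obj A ◁ (Z ◁ (𝐌 S).ret A' ▷ Y' ≫ v') ≫
        (X ◁ (𝐌 S).T.obj A ◁ v ≫ (MonoidalMonad.twoHole X _ Z _ Y').hom ≫ u ▷ _) ≫
          (𝐌 S).ext h := by
    simp only [MonoidalCategory.whiskerLeft_comp, Category.assoc]
    rw [← whiskerLeft_comp_assoc X (_ ◁ v'), ← MonoidalCategory.whiskerLeft_comp, hvv,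
      MonoidalCategory.whiskerLeft_id, MonoidalCategory.whiskerLeft_id, Category.id_comp,
      MonoidalMonad.whiskerRight_ext, ← Category.assoc (X ◁ _), MonoidalMonad.ret_twoHole_hom,
      Category.assoc, MonoidalMonad.ret_ext]
  obtain ⟨k, hk⟩ := ih (.comp (.twoHole_hom X _ Z A' Y') (hu.whiskerRight _)) (by
    rw [eh, gr_comp, gr_whiskerLeft_inR, gr_whiskerLeft_inL]
    exact hg)
  refine ⟨X ◁ A ◁ v ≫ (MonoidalMonad.twoHole X A Z _ Y').hom ≫
    (𝐌 S).ext ((MonoidalMonad.twoHole X A Z A' Y').inv ≫ k), ?_⟩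
  rw [← MonoidalMonad.whiskerLeft_ext, ← MonoidalMonad.ext_twoHole, ← hk]
  simp only [Category.assoc, Iso.inv_hom_id_assoc, MonoidalMonad.whiskerRight_ext]

theorem exists_ext_of_right {X A Z A' X' Y Y' B : LS S}
    {s : X ⊗ (𝐌 S).T.obj A ⊗ Y ⟶ X' ⊗ (𝐌 S).T.obj A' ⊗ Y'} (hs : Str s)
    {h : X' ⊗ A' ⊗ Y' ⟶ (𝐌 S).T.obj B}
    (hX : items X = items (X' ⊗ (𝐌 S).T.obj A' ⊗ Z))
    (hY : items (Z ⊗ (𝐌 S).T.obj A ⊗ Y) = items Y')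
    (hg : gr (s ≫ (𝐌 S).ext h) (inR (inL root)) = root)
    (ih : ∀ {P R : LS S} {t : P ⊗ (𝐌 S).T.obj A ⊗ R ⟶ X' ⊗ A' ⊗ Y'}, Str t →
      gr (t ≫ h) (inR (inL root)) = root → ∃ k, t ≫ h = (𝐌 S).ext k) :
    ∃ k, s ≫ (𝐌 S).ext h = (𝐌 S).ext k := by
  obtain ⟨u, hu⟩ := Str.exists_of_items_eq hX
  obtain ⟨v, hv⟩ := Str.exists_of_items_eq hY
  obtain ⟨u', hu', -, huu⟩ := hu.exists_inv
  obtain rfl := hs.unique (.comp (hu.whiskerRight _)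
    (.comp (.twoHole_inv _ _ _ _ _) (hv.whiskerLeft _ |>.whiskerLeft X')))
  have eh : ((MonoidalMonad.twoHole X' A' Z ((𝐌 S).T.obj A) Y).inv ≫ X' ◁ A' ◁ v) ≫ h =
      (X' ◁ (𝐌 S).ret A' ▷ Z ≫ u') ▷ ((𝐌 S).T.obj A ⊗ Y) ≫
        (u ▷ _ ≫ (MonoidalMonad.twoHole X' _ Z _ Y).inv ≫ X' ◁ (𝐌 S).T.obj A' ◁ v) ≫
          (𝐌 S).ext h := by
    simp only [MonoidalCategory.comp_whiskerRight, Category.assoc]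
    rw [← comp_whiskerRight_assoc u', huu,
      MonoidalCategory.id_whiskerRight, Category.id_comp,
      MonoidalMonad.whiskerLeft_ext, ← Category.assoc (_ ▷ _), MonoidalMonad.ret_twoHole_inv,
      Category.assoc, MonoidalMonad.ret_ext]
  obtain ⟨k, hk⟩ := ih (.comp (.twoHole_inv X' A' Z _ Y) (hv.whiskerLeft _ |>.whiskerLeft X')) (by
    rw [eh, gr_comp, gr_whiskerRight_inR]
    exact hg)
  refine ⟨u ▷ _ ≫ (MonoidalMonad.twoHole X' _ Z A Y).inv ≫
    (𝐌 S).ext ((MonoidalMonad.twoHole X' A' Z A Y).hom ≫ k), ?_⟩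
  have e := (𝐌 S).ext_twoHole ((MonoidalMonad.twoHole X' A' Z A Y).hom ≫ k)
  rw [Iso.inv_hom_id_assoc, ← Iso.eq_inv_comp, ← hk] at e
  simp only [Category.assoc, Iso.hom_inv_id_assoc, ← MonoidalMonad.whiskerLeft_ext] at e
  simp only [Category.assoc, ← MonoidalMonad.whiskerRight_ext, e]

/-- An arrow that merges a given outermost occurrence of `T` of the source into the outermost one
of the target is a Kleisli extension. -/
def ExtForm : ∀ {D : LS S} (E : LS S), (D ⟶ E) → Prop
  | D, T B, f => ∀ {X A Y : LS S} {s : X ⊗ (𝐌 S).T.obj A ⊗ Y ⟶ D}, Str s →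
      gr (s ≫ (show D ⟶ (𝐌 S).T.obj B from f)) (inR (inL root)) = root →
      ∃ k, s ≫ (show D ⟶ (𝐌 S).T.obj B from f) = (𝐌 S).ext k
  | _, _, _ => True

/-- Since `s` preserves the list of atoms, the marked `T A` is the opened `T A'` itself or lies on
one side of it. In the first case the context arrows slide inside; in the others the rules are
permuted. -/
theorem Der.extForm {D E : LS S} {f : D ⟶ E} (h : Der f) : ExtForm E f := by
  induction h with
  | letter | unit | tensor => trivial
  | @ret D B f _ _ =>
    intro X A Y s hs hg
    have hg' : gr (s ≫ f ≫ (𝐌 S).ret B) (inR (inL root)) = root := hg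
    rw [gr_comp, gr_comp, gr_ret] at hg'
    exact (inT_ne_root _ hg').elim
  | @ext X' A' Y' B f _ ih =>
    intro X A Y s hs hg
    have e := hs.items_eq
    simp only [items_tensor, items_T, List.singleton_append] at e
    obtain ⟨l, h₁, h₂⟩ | ⟨l, h₁, h₂⟩ := List.append_eq_append_iff.1 e
    · rcases l with - | ⟨i, l⟩
      · obtain ⟨⟨⟩, hY⟩ : Item.T A = Item.T A' ∧ items Y = items Y' := by simpa using h₂
        obtain ⟨u, hu⟩ := Str.exists_of_items_eq (A := X) (B := X') (by simpa using h₁.symm)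
        obtain ⟨v, hv⟩ := Str.exists_of_items_eq hY
        obtain rfl := hs.unique (.tensor hu (.tensor (.id _) hv))
        exact ⟨_, (𝐌 S).ext_context_natural u v f⟩
      · obtain ⟨rfl, hY⟩ : Item.T A = i ∧ items Y = l ++ .T A' :: items Y' := by simpa using h₂
        exact exists_ext_of_left (Z := ofList l) hs (by simp [h₁]) (by simp [hY]) hg ih
    · rcases l with - | ⟨i, l⟩
      · obtain ⟨⟨⟩, hY⟩ : Item.T A' = Item.T A ∧ items Y' = items Y := by simpa using h₂
        obtain ⟨u, hu⟩ := Str.exists_of_items_eq (A := X) (B := X') (by simpa using h₁)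
        obtain ⟨v, hv⟩ := Str.exists_of_items_eq hY.symm
        obtain rfl := hs.unique (.tensor hu (.tensor (.id _) hv))
        exact ⟨_, (𝐌 S).ext_context_natural u v f⟩
      · obtain ⟨rfl, hY⟩ : Item.T A' = i ∧ items Y' = l ++ .T A :: items Y := by simpa using h₂
        exact exists_ext_of_right (Z := ofList l) hs (by simp [h₁]) (by simp [hY]) hg ih
  | @str D' D E t f ht _ ih =>
    cases E with
    | T B =>
      intro X A Y s hs hg
      have e := Category.assoc s t (show D ⟶ (𝐌 S).T.obj B from f)
      obtain ⟨k, hk⟩ := ih (hs.comp ht)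
        ((congrArg (fun a => gr a (inR (inL root))) e).trans hg)
      exact ⟨k, e.symm.trans hk⟩
    | _ => trivial

theorem exists_eq_ext {X A Y B : LS S} (f : X ⊗ (𝐌 S).T.obj A ⊗ Y ⟶ (𝐌 S).T.obj B)
    (h : gr f (inR (inL root)) = root) : ∃ k, f = (𝐌 S).ext k := by
  obtain ⟨k, hk⟩ := (der f).extForm (.id _) (by rw [Category.id_comp]; exact h)
  exact ⟨k, (Category.id_comp _).symm.trans hk⟩

/-! ### How the graph determines a splitting of the source -/

/-- The number of occurrences of letters in an object. -/
def letters : LS S → ℕ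
  | letter _ => 1
  | unit => 0
  | tensor A B => letters A + letters B
  | T A => letters A

theorem Term.letters_eq {A B : LS S} (f : Term A B) : letters A = letters B := by
  induction f <;> simp_all [letters, Nat.add_assoc]

theorem letters_eq {A B : LS S} (f : A ⟶ B) : letters A = letters B := by
  obtain ⟨f⟩ := f
  exact f.letters_eq

theorem letters_tensor (A B : LS S) : letters (A ⊗ B) = letters A + letters B := rfl

theorem eq_nil_of_letters_eq_zero {Γ : List (Item S)} (h : letters (ofList Γ) = 0)
    (hT : Occ (ofList Γ) → False) : Γ = [] := by
  rcases Γ with - | ⟨i | A, Γ⟩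
  · rfl
  · rw [ofList, letters_tensor] at h
    change 1 + _ = 0 at h
    omega
  · exact (hT (inL (A := (𝐌 S).T.obj A) root)).elim

/-- Suppose `s` shifts `Γ` from the right factor to the left one. Then `Γ` has no letters, since
`A₁` and `A₁'` both have as many as `B₁`. It has no `T` either: one graph would send it into `B₂`
and the other into `B₁`. -/
theorem eq_nil_of_shift {A₁ A₂ A₁' A₂' B₁ B₂ : LS S} {s : A₁ ⊗ A₂ ⟶ A₁' ⊗ A₂'} (hs : Str s)
    {f₁ : A₁ ⟶ B₁} {f₂ : A₂ ⟶ B₂} {g₁ : A₁' ⟶ B₁} {g₂ : A₂' ⟶ B₂}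
    (h : gr (s ≫ (g₁ ⊗ₘ g₂)) = gr (f₁ ⊗ₘ f₂)) {Γ : List (Item S)}
    (h₁ : items A₁' = items A₁ ++ Γ) (h₂ : items A₂ = Γ ++ items A₂') : Γ = [] := by
  obtain ⟨u, hu⟩ := Str.exists_of_items_eq (A := A₁ ⊗ ofList Γ) (B := A₁') (by simp [h₁])
  obtain ⟨v, hv⟩ := Str.exists_of_items_eq (A := ofList Γ ⊗ A₂') (B := A₂) (by simp [h₂])
  refine eq_nil_of_letters_eq_zero ?_ fun x => ?_
  · have := letters_eq (u ≫ g₁)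
    rw [letters_tensor, ← letters_eq f₁] at this
    omega
  · have e : A₁ ◁ v ≫ s = (α_ _ _ _).inv ≫ u ▷ A₂' :=
      Str.unique (.comp (hv.whiskerLeft _) hs) (.comp (.α_inv _ _ _) (hu.whiskerRight _))
    have h' := congrFun h (gr (A₁ ◁ v) (inR (inL x)))
    rw [← gr_comp, reassoc_of% e, gr_comp, gr_comp, gr_associator_inv_inR_inL,
      gr_whiskerRight_inL, gr_tensorHom_inL, gr_whiskerLeft_inR, gr_tensorHom_inR] at h'
    exact inL_ne_inR _ _ h'

theorem Str.exists_tensor {A₁ A₂ A₁' A₂' B₁ B₂ : LS S} {s : A₁ ⊗ A₂ ⟶ A₁' ⊗ A₂'} (hs : Str s)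
    {f₁ : A₁ ⟶ B₁} {f₂ : A₂ ⟶ B₂} {g₁ : A₁' ⟶ B₁} {g₂ : A₂' ⟶ B₂}
    (h : gr (s ≫ (g₁ ⊗ₘ g₂)) = gr (f₁ ⊗ₘ f₂)) :
    ∃ (s₁ : A₁ ⟶ A₁') (s₂ : A₂ ⟶ A₂'), s = s₁ ⊗ₘ s₂ := by
  have e := hs.items_eq
  simp only [items_tensor] at e
  obtain ⟨h₁, h₂⟩ : items A₁ = items A₁' ∧ items A₂ = items A₂' := by
    obtain ⟨Γ, h₁, h₂⟩ | ⟨Γ, h₁, h₂⟩ := List.append_eq_append_iff.1 e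
    · obtain rfl := eq_nil_of_shift hs h h₁ h₂
      simp_all
    -- A shift in the other direction is a shift for the inverse of `s`, with `f` and `g`
    -- interchanged.
    · obtain ⟨t, ht, -, e'⟩ := hs.exists_inv
      have h' : gr (t ≫ (f₁ ⊗ₘ f₂)) = gr (g₁ ⊗ₘ g₂) := by
        funext x
        rw [gr_comp, ← h, ← gr_comp, reassoc_of% e']
      obtain rfl := eq_nil_of_shift ht h' h₁ h₂
      simp_all
  obtain ⟨s₁, hs₁⟩ := Str.exists_of_items_eq h₁
  obtain ⟨s₂, hs₂⟩ := Str.exists_of_items_eq h₂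
  exact ⟨s₁, s₂, hs.unique (.tensor hs₁ hs₂)⟩

/-! ### Faithfulness -/

theorem Der.eq_of_gr_eq {A B : LS S} {f : A ⟶ B} (hf : Der f) (g : A ⟶ B) (h : gr g = gr f) :
    g = f := by
  induction hf with
  | letter p => exact Str.unique (der g).cutFreeForm (.id _)
  | unit => exact Str.unique (der g).cutFreeForm (.id _)
  | tensor _ _ ih₁ ih₂ =>
    obtain ⟨A₁, A₂, s, g₁, g₂, hs, -, -, rfl⟩ := (der g).exists_of_tensor
    obtain ⟨s₁, s₂, rfl⟩ := hs.exists_tensor h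
    rw [tensorHom_comp_tensorHom] at h ⊢
    rw [ih₁ (s₁ ≫ g₁), ih₂ (s₂ ≫ g₂)]
    · funext x
      exact inR_injective (by simpa only [gr_tensorHom_inR] using congrFun h (inR x))
    · funext x
      exact inL_injective (by simpa only [gr_tensorHom_inL] using congrFun h (inL x))
  | ret _ ih =>
    obtain ⟨g', -, rfl⟩ | ⟨X, Q, Y, s, g', hs, rfl⟩ := (der g).cutFreeForm
    · rw [ih g']
      funext x
      exact inT_injective (by simpa only [gr_comp, gr_ret] using congrFun h x)
    -- The `T` opened by the extension is pulled back along `s`; `g` sends it to the outermost `T`,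
    -- which the other graph misses.
    · obtain ⟨t, -, -, e⟩ := hs.exists_inv
      have h' := congrFun h (gr t (inR (inL root)))
      rw [← gr_comp, reassoc_of% e, gr_ext_root, gr_comp, gr_ret] at h'
      exact (inT_ne_root _ h'.symm).elim
  | @ext X A Y B f _ ih =>
    obtain ⟨k, rfl⟩ := exists_eq_ext g (by rw [h, gr_ext_root])
    suffices e : gr k = gr f by rw [ih k e]
    -- Restricting an extension along the unit of `T` returns its premise, so the graphs of the
    -- extensions determine those of the premises.
    rw [← (𝐌 S).ret_ext k, ← (𝐌 S).ret_ext f]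
    funext x
    rw [gr_comp, gr_comp, h]
  | str hs _ ih =>
    obtain ⟨t, -, e₁, e₂⟩ := hs.exists_inv
    rw [← ih (t ≫ g), reassoc_of% e₁]
    funext x
    rw [gr_comp, h, ← gr_comp, reassoc_of% e₂]

theorem eq_of_gr_eq {A B : LS S} {f g : A ⟶ B} (h : gr f = gr g) : f = g :=
  (der g).eq_of_gr_eq f h

end LS

theorem mainTheorem1 (S : Type u) :
    (LS.G S).Faithful ∧
      ∀ (A B : LS S) (f g : LS.Term A B), f.arrow = g.arrow ↔ LS.graph f = LS.graph g := by
  refine ⟨⟨fun {A B} f g h => LS.eq_of_gr_eq ?_⟩, fun A B f g => ⟨congrArg LS.gr,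
    fun h => LS.eq_of_gr_eq h⟩⟩
  obtain ⟨f⟩ := f
  obtain ⟨g⟩ := g
  funext x
  -- Numbering occurrences is a bijection, so equality under `G` is equality of graphs on
  -- occurrences.
  have h' := congrArg ULift.down (congrFun h (ULift.up (LS.number A x)))
  have e : LS.number B (LS.graph f ((LS.number A).symm (LS.number A x))) =
    LS.number B (LS.graph g ((LS.number A).symm (LS.number A x))) := h'
  rw [Equiv.symm_apply_apply] at e
  exact (LS.number B).injective e
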